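/- Let $U$ be the universal enveloping algebra of the real Lie algebra $\mathfrak{su}(3)$ (traceless anti-hermitian $3\times3$ matrices), with complex coefficients. Let $\lambda_1,\dots,\lambda_8$ be the Gell-Mann matrices (normalized by $\mathrm{Tr}(\lambda_a\lambda_b)=2\delta_{ab}$), and let $L_a\in U$ be the generators such that $iL_a\in\mathfrak{su}(3)$ is the matrix $i\lambda_a$. Put $L_{jk}=(L_j+iL_k)/2$ and $\overline{L_{jk}}=(L_j-iL_k)/2$ for $(j,k)=(1,2),(4,5),(6,7)$, $h_1=L_3$, $h_2=(-L_3+\sqrt3\,L_8)/2$. Let $\widehat\Omega_2=-\sum_{a=1}^8\widehat X_a\widehat X_a$ with $\widehat X_a=iL_a/\sqrt2$ (the quadratic Casimir element for the Killing form divided by $6$), and let $$\begin{aligned}\Omega_3={}&\tfrac13 h_1\left(\overline{L_{12}}L_{12}+\overline{L_{45}}L_{45}-2\,\overline{L_{67}}L_{67}\right)+\tfrac13 h_2\left(2\,\overline{L_{12}}L_{12}-\overline{L_{45}}L_{45}-\overline{L_{67}}L_{67}\right)\\&+\overline{L_{45}}L_{67}L_{12}+\overline{L_{67}}\,\overline{L_{12}}L_{45}+\overline{L_{12}}L_{12}-\overline{L_{67}}L_{67}\\&+\tfrac13\left(\tfrac13(h_2h_1h_1-h_2h_2h_1)+\tfrac29(h_1h_1h_1-h_2h_2h_2)+(h_1h_1-h_2h_2)+(h_1-h_2)\right).\end{aligned}$$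 Call an element of $U$ cubic if it is a complex linear combination of products of at most three elements of $\mathfrak{su}(3)$, but not of products of at most two. The constant term of an element is its image under the algebra homomorphism $U\to\mathbb C$ that kills $\mathfrak{su}(3)$. An element is hermitian if it is fixed by the antilinear anti-automorphism of $U$ that fixes every $L_a$. (1) An element $z\in U$ is cubic and central if and only if, up to its constant term, it is a nonzero multiple of $\Omega_3+x\,\tfrac32\widehat\Omega_2$: that is, $z=c\left(\Omega_3+x\,\tfrac32\,\widehat\Omega_2\right)+\varepsilon$ for some $c,x\in\mathbb C$ with $c\neq0$, where $\varepsilon$ is the constant term of $z$. (2) An element $z\in U$ is cubic, central, hermitian and has constant term zero if and only if $z=c\left(\Omega_3+x\,\tfrac32\,\widehat\Omega_2\right)$ for some real $c\neq0$ and some real $x$. (3) In every irreducible complex representation of $\mathfrak{su}(3)$ of highest weight $(o_1,o_2)$, $o_1,o_2\in\mathbb Z_{\ge0}$ (components in the basis of fundamental weights, for the raising operators $L_{12},L_{45},L_{67}$ and the coroots $h_1,h_2$), $\Omega_3$ acts as the scalar $$\frac{(o_1-o_2)(3+2o_1+o_2)(3+o_1+2o_2)}{27}.$$ -/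

import Mathlib

open scoped TensorProduct Matrix

attribute [local instance 100] LieRing.ofAssociativeRing

noncomputable section

/-- The real Lie algebra `su(3)` of traceless anti-hermitian complex `3 × 3` matrices. -/
def su3 : LieSubalgebra ℝ (Matrix (Fin 3) (Fin 3) ℂ) where
  carrier := {A | Aᴴ = -A ∧ A.trace = 0}
  add_mem' := by
    rintro A B ⟨hA, hA'⟩ ⟨hB, hB'⟩
    refine ⟨?_, ?_⟩
    · rw [Matrix.conjTranspose_add, hA, hB, neg_add]
    · rw [Matrix.trace_add, hA', hB', add_zero]
  zero_mem' := by simp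
  smul_mem' := by
    rintro c A ⟨hA, hA'⟩
    refine ⟨?_, ?_⟩
    · rw [Matrix.conjTranspose_smul, hA, star_trivial, smul_neg]
    · rw [Matrix.trace_smul, hA', smul_zero]
  lie_mem' := by
    rintro A B ⟨hA, -⟩ ⟨hB, -⟩
    refine ⟨?_, ?_⟩
    · rw [Ring.lie_def, Matrix.conjTranspose_sub, Matrix.conjTranspose_mul,
        Matrix.conjTranspose_mul, hA, hB]
      simp
    · rw [Ring.lie_def, Matrix.trace_sub, Matrix.trace_mul_comm, sub_self]

/-- The Gell-Mann matrices; `gellMann a` is the matrix usually called `λ_{a+1}`. -/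
def gellMann : Fin 8 → Matrix (Fin 3) (Fin 3) ℂ :=
  ![!![0, 1, 0; 1, 0, 0; 0, 0, 0],
    !![0, -Complex.I, 0; Complex.I, 0, 0; 0, 0, 0],
    !![1, 0, 0; 0, -1, 0; 0, 0, 0],
    !![0, 0, 1; 0, 0, 0; 1, 0, 0],
    !![0, 0, -Complex.I; 0, 0, 0; Complex.I, 0, 0],
    !![0, 0, 0; 0, 0, 1; 0, 1, 0],
    !![0, 0, 0; 0, 0, -Complex.I; 0, Complex.I, 0],
    ((1 / Real.sqrt 3 : ℝ) : ℂ) • !![1, 0, 0; 0, 1, 0; 0, 0, -2]]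

theorem I_smul_gellMann_mem (a : Fin 8) : Complex.I • gellMann a ∈ su3 := by
  show (Complex.I • gellMann a)ᴴ = -(Complex.I • gellMann a) ∧
    (Complex.I • gellMann a).trace = 0
  refine ⟨?_, ?_⟩
  · ext i j
    fin_cases a <;> fin_cases i <;> fin_cases j <;>
      simp [gellMann, Complex.conj_ofReal]
  · fin_cases a <;> simp [gellMann, Matrix.trace_fin_three]; ring

/-- The basis element `i L_{a+1}` of `su(3)`, given by the matrix `i λ_{a+1}`. -/
def su3Basis (a : Fin 8) : su3 := ⟨Complex.I • gellMann a, I_smul_gellMann_mem a⟩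

/-- The universal enveloping algebra of `su(3)`, with complex coefficients. -/
abbrev USu3 : Type := ℂ ⊗[ℝ] UniversalEnvelopingAlgebra ℝ su3

namespace USu3

/-- The canonical map from `su(3)` to its enveloping algebra. -/
def ofLie (X : su3) : USu3 := 1 ⊗ₜ[ℝ] UniversalEnvelopingAlgebra.ι ℝ X

/-- The elements of degree at most `n`: complex linear combinations of products of at most `n`
elements of `su(3)`. -/
def degreeLE (n : ℕ) : Submodule ℂ USu3 :=
  Submodule.span ℂ {z | ∃ l : List su3, l.length ≤ n ∧ z = (l.map ofLie).prod}

/-- Elements of degree exactly three. -/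
def IsCubic (z : USu3) : Prop := z ∈ degreeLE 3 ∧ z ∉ degreeLE 2

theorem commute_ofId (A : Type*) [Ring A] [Algebra ℂ A]
    (g : UniversalEnvelopingAlgebra ℝ su3 →ₐ[ℝ] A) (c : ℂ) (u : UniversalEnvelopingAlgebra ℝ su3) :
    Commute (Algebra.ofId ℂ A c) (g u) :=
  Algebra.commutes c _

/-- The action of the enveloping algebra on a complex vector space `V` that extends a
representation `ρ` of `su(3)` on `V`. -/
def eval {V : Type*} [AddCommGroup V] [Module ℂ V] (ρ : su3 →ₗ⁅ℝ⁆ Module.End ℂ V) :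
    USu3 →ₐ[ℂ] Module.End ℂ V :=
  Algebra.TensorProduct.lift (Algebra.ofId ℂ (Module.End ℂ V))
    (UniversalEnvelopingAlgebra.lift ℝ ρ) (commute_ofId (Module.End ℂ V) _)

/-- The constant term (augmentation): the algebra homomorphism to `ℂ` that kills `su(3)`. -/
def constTerm : USu3 →ₐ[ℂ] ℂ :=
  Algebra.TensorProduct.lift (AlgHom.id ℂ ℂ)
    (UniversalEnvelopingAlgebra.lift ℝ (0 : su3 →ₗ⁅ℝ⁆ ℂ)) (fun _ _ => Commute.all _ _)

/-- The anti-automorphism of the real enveloping algebra with `X ↦ -X` for `X ∈ su(3)`. -/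
def antipode : UniversalEnvelopingAlgebra ℝ su3 →ₐ[ℝ] (UniversalEnvelopingAlgebra ℝ su3)ᵐᵒᵖ :=
  UniversalEnvelopingAlgebra.lift ℝ
    { toFun := fun X => MulOpposite.op (-UniversalEnvelopingAlgebra.ι ℝ X)
      map_add' := by
        intro X Y
        rw [map_add, neg_add, MulOpposite.op_add]
      map_smul' := by
        intro c X
        rw [map_smul, ← smul_neg, MulOpposite.op_smul, RingHom.id_apply]
      map_lie' := by
        intro X Y
        rw [LieHom.map_lie, Ring.lie_def, Ring.lie_def, ← MulOpposite.op_mul,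
          ← MulOpposite.op_mul, ← MulOpposite.op_sub]
        congr 1
        noncomm_ring }

/-- The hermitian conjugation of the enveloping algebra: the antilinear anti-automorphism that
sends each `X ∈ su(3)` to `-X` (so that the generators `L_a` are self-adjoint). -/
def adj : USu3 →ₗ[ℝ] USu3 :=
  TensorProduct.map Complex.conjAe.toLinearMap
    ((MulOpposite.opLinearEquiv ℝ).symm.toLinearMap ∘ₗ antipode.toLinearMap)

/-- The generator `L_{a+1}`, characterised by `i L_{a+1} = su3Basis a`. -/
def L (a : Fin 8) : USu3 := (-Complex.I) • ofLie (su3Basis a)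

/-- `L₁₂ = (L₁ + i L₂) / 2`. -/
def L₁₂ : USu3 := (1 / 2 : ℂ) • (L 0 + Complex.I • L 1)
/-- `L₄₅ = (L₄ + i L₅) / 2`. -/
def L₄₅ : USu3 := (1 / 2 : ℂ) • (L 3 + Complex.I • L 4)
/-- `L₆₇ = (L₆ + i L₇) / 2`. -/
def L₆₇ : USu3 := (1 / 2 : ℂ) • (L 5 + Complex.I • L 6)
/-- `(L₁ - i L₂) / 2`, the conjugate of `L₁₂`. -/
def Lbar₁₂ : USu3 := (1 / 2 : ℂ) • (L 0 - Complex.I • L 1)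
/-- `(L₄ - i L₅) / 2`, the conjugate of `L₄₅`. -/
def Lbar₄₅ : USu3 := (1 / 2 : ℂ) • (L 3 - Complex.I • L 4)
/-- `(L₆ - i L₇) / 2`, the conjugate of `L₆₇`. -/
def Lbar₆₇ : USu3 := (1 / 2 : ℂ) • (L 5 - Complex.I • L 6)
/-- `h₁ = L₃`. -/
def h₁ : USu3 := L 2
/-- `h₂ = (-L₃ + √3 L₈) / 2`. -/
def h₂ : USu3 := (1 / 2 : ℂ) • (-L 2 + ((Real.sqrt 3 : ℝ) : ℂ) • L 7)

/-- The basis `X̂_a = i L_a / √2` of `su(3)`, orthonormal for minus one sixth of the Killing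
form, seen in the enveloping algebra. -/
def Xhat (a : Fin 8) : USu3 := ((1 / Real.sqrt 2 : ℝ) : ℂ) • ofLie (su3Basis a)

/-- The quadratic Casimir element for the renormalized Killing form. -/
def Ω₂hat : USu3 := -∑ a, Xhat a * Xhat a

/-- The cubic element `Ω₃`. -/
def Ω₃ : USu3 :=
  (1 / 3 : ℂ) • (h₁ * (Lbar₁₂ * L₁₂ + Lbar₄₅ * L₄₅ - (2 : ℂ) • (Lbar₆₇ * L₆₇)))
  + (1 / 3 : ℂ) • (h₂ * ((2 : ℂ) • (Lbar₁₂ * L₁₂) - Lbar₄₅ * L₄₅ - Lbar₆₇ * L₆₇))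
  + Lbar₄₅ * L₆₇ * L₁₂ + Lbar₆₇ * Lbar₁₂ * L₄₅
  + Lbar₁₂ * L₁₂ - Lbar₆₇ * L₆₇
  + (1 / 3 : ℂ) • ((1 / 3 : ℂ) • (h₂ * h₁ * h₁ - h₂ * h₂ * h₁)
      + (2 / 9 : ℂ) • (h₁ * h₁ * h₁ - h₂ * h₂ * h₂)
      + (h₁ * h₁ - h₂ * h₂) + (h₁ - h₂))

/-- `ρ` is an irreducible complex representation of `su(3)` with highest weight `(o₁, o₂)` in the
basis of fundamental weights: there is a nonzero vector killed by the raising operators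
`L₁₂`, `L₄₅`, `L₆₇` on which the coroots `h₁`, `h₂` take the values `o₁`, `o₂`. -/
structure IsIrrepOfHighestWeight {V : Type*} [AddCommGroup V] [Module ℂ V]
    (ρ : su3 →ₗ⁅ℝ⁆ Module.End ℂ V) (o₁ o₂ : ℕ) : Prop where
  irreducible : ∀ W : Submodule ℂ V, (∀ X : su3, ∀ w ∈ W, ρ X w ∈ W) → W = ⊥ ∨ W = ⊤
  highestWeight : ∃ v : V, v ≠ 0 ∧
    eval ρ L₁₂ v = 0 ∧ eval ρ L₄₅ v = 0 ∧ eval ρ L₆₇ v = 0 ∧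
    eval ρ h₁ v = (o₁ : ℂ) • v ∧ eval ρ h₂ v = (o₂ : ℂ) • v

end USu3

end

/-! ### Generators of the enveloping algebra and the extension to complex matrices -/

noncomputable section

namespace USu3

/-! The classification rests on symbols, obtained here without the Poincaré–Birkhoff–Witt theorem.
`tensorCube` lets `U` act on the third tensor power of `ℂ³`, each Lie element acting diagonally.
Pair the image with `a ⊗ b ⊗ c`, where the three linear forms kill `1`. A product of at most two Lie
elements leaves a `1` in some slot and pairs to zero; a product of three contributes the sum over
its six distributions among the slots. These pairings are therefore the cubic symbol of an element
of degree at most three: a symmetric trilinear form, zero on degree at most two. Multiplying the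
slots back together in `U` yields the symmetrisation, which is six times the element modulo degree
two, so an element whose symbol vanishes drops in degree. With the normalised trace in one or two
slots, the same device handles quadratic and linear symbols.

The symbol of a central element is invariant under the adjoint action. On `sl(3)` there is no
nonzero invariant linear form, and invariant symmetric bilinear and trilinear forms are each
determined by a single value (namespace `InvariantTensor`). Hence a cubic central element becomes
constant after suitable multiples of `Ω₃` and `Ω₂hat` are subtracted; the multiples are read off by
`cubicCoeff` and `quadraticCoeff`. Since `cubicCoeff` kills degree two and equals `1` on `Ω₃`, the
latter is genuinely cubic.

Centrality of the two Casimir elements is a normal-ordering computation in a Chevalley basis, and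
hermiticity of `Ω₃` another. For the scalar, every monomial of `Ω₃` that contains a raising operator
ends in one, so on a highest weight vector only the polynomial in the coroots survives;
irreducibility spreads this value to the whole space. -/

theorem ofLie_add (X Y : su3) : ofLie (X + Y) = ofLie X + ofLie Y := by
  simp only [ofLie, map_add, TensorProduct.tmul_add]

theorem ofLie_smul (r : ℝ) (X : su3) : ofLie (r • X) = (r : ℂ) • ofLie X := by
  simp only [ofLie, map_smul, TensorProduct.tmul_smul, TensorProduct.smul_tmul']
  simp

theorem ofLie_lie (X Y : su3) : ofLie ⁅X, Y⁆ = ofLie X * ofLie Y - ofLie Y * ofLie X := by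
  simp only [ofLie, LieHom.map_lie, Ring.lie_def, TensorProduct.tmul_sub,
    Algebra.TensorProduct.tmul_mul_tmul, mul_one]

/-- The extension of a real Lie algebra homomorphism from `su(3)` to a complex algebra to the
enveloping algebra. -/
def liftC {A : Type*} [Ring A] [Algebra ℂ A] (f : su3 →ₗ⁅ℝ⁆ A) : USu3 →ₐ[ℂ] A :=
  Algebra.TensorProduct.lift (Algebra.ofId ℂ A)
    (UniversalEnvelopingAlgebra.lift ℝ f) (commute_ofId A _)

@[simp] theorem liftC_ofLie {A : Type*} [Ring A] [Algebra ℂ A] (f : su3 →ₗ⁅ℝ⁆ A) (X : su3) :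
    liftC f (ofLie X) = f X := by
  simp only [liftC, ofLie, Algebra.TensorProduct.lift_tmul, map_one, one_mul,
    UniversalEnvelopingAlgebra.lift_ι_apply]

theorem eval_ofLie {V : Type*} [AddCommGroup V] [Module ℂ V] (ρ : su3 →ₗ⁅ℝ⁆ Module.End ℂ V)
    (X : su3) : eval ρ (ofLie X) = ρ X := liftC_ofLie ρ X

theorem constTerm_ofLie (X : su3) : constTerm (ofLie X) = 0 := by
  simp only [constTerm, ofLie, Algebra.TensorProduct.lift_tmul, map_one, one_mul,
    UniversalEnvelopingAlgebra.lift_ι_apply, LieHom.zero_apply]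

/-- The map `ι` corestricts to the generated subalgebra and lifts from there; lift followed by
inclusion agrees with the identity on `ι`, hence everywhere by the universal property. -/
theorem _root_.UniversalEnvelopingAlgebra.adjoin_range_ι {R 𝔤 : Type*} [CommRing R] [LieRing 𝔤]
    [LieAlgebra R 𝔤] :
    Algebra.adjoin R (Set.range (UniversalEnvelopingAlgebra.ι R : 𝔤 → _)) = ⊤ := by
  set S := Algebra.adjoin R (Set.range (UniversalEnvelopingAlgebra.ι R : 𝔤 → _)) with hS
  let f : 𝔤 →ₗ⁅R⁆ S :=
    { toFun := fun X => ⟨UniversalEnvelopingAlgebra.ι R X, Algebra.subset_adjoin ⟨X, rfl⟩⟩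
      map_add' := fun X Y => Subtype.ext (map_add _ X Y)
      map_smul' := fun c X => Subtype.ext (map_smul _ c X)
      map_lie' := fun {X Y} => Subtype.ext (LieHom.map_lie _ X Y) }
  have h : S.val.comp (UniversalEnvelopingAlgebra.lift R f) = AlgHom.id R _ := by
    apply UniversalEnvelopingAlgebra.hom_ext
    ext X
    show S.val (UniversalEnvelopingAlgebra.lift R f (UniversalEnvelopingAlgebra.ι R X)) = _
    rw [UniversalEnvelopingAlgebra.lift_ι_apply]
    rfl
  rw [eq_top_iff]
  intro x _
  have hx := DFunLike.congr_fun h x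
  rw [AlgHom.id_apply] at hx
  rw [← hx]
  exact (UniversalEnvelopingAlgebra.lift R f x).2

theorem adjoin_range_ofLie : Algebra.adjoin ℂ (Set.range ofLie) = ⊤ := by
  rw [eq_top_iff]
  rintro z -
  induction z using TensorProduct.induction_on with
  | zero => exact zero_mem _
  | add x y hx hy => exact add_mem hx hy
  | tmul c u =>
    have hu : u ∈ Algebra.adjoin ℝ (Set.range (UniversalEnvelopingAlgebra.ι ℝ : su3 → _)) := by
      rw [UniversalEnvelopingAlgebra.adjoin_range_ι]; trivial
    have h1 : (1 : ℂ) ⊗ₜ[ℝ] u ∈ Algebra.adjoin ℂ (Set.range ofLie) := by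
      induction hu using Algebra.adjoin_induction with
      | mem x hx =>
        obtain ⟨X, rfl⟩ := hx
        exact Algebra.subset_adjoin ⟨X, rfl⟩
      | algebraMap r =>
        have : (1 : ℂ) ⊗ₜ[ℝ] (algebraMap ℝ (UniversalEnvelopingAlgebra ℝ su3) r)
            = algebraMap ℂ USu3 (r : ℂ) := by
          rw [Algebra.algebraMap_eq_smul_one, Algebra.algebraMap_eq_smul_one,
            TensorProduct.tmul_smul, TensorProduct.smul_tmul', Algebra.TensorProduct.one_def,
            TensorProduct.smul_tmul']
          simp
        rw [this]
        exact algebraMap_mem _ _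
      | add x y _ _ hx hy => rw [TensorProduct.tmul_add]; exact add_mem hx hy
      | mul x y _ _ hx hy =>
        have := mul_mem hx hy
        rwa [Algebra.TensorProduct.tmul_mul_tmul, mul_one] at this
    have := Subalgebra.smul_mem _ h1 c
    rwa [TensorProduct.smul_tmul', smul_eq_mul, mul_one] at this

theorem mem_center_of_commute_ofLie {z : USu3} (h : ∀ X, ofLie X * z = z * ofLie X) :
    z ∈ Subalgebra.center ℂ USu3 := by
  rw [Subalgebra.mem_center_iff]
  intro u
  have hu : u ∈ Algebra.adjoin ℂ (Set.range ofLie) := by rw [adjoin_range_ofLie]; trivial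
  induction hu using Algebra.adjoin_induction with
  | mem x hx => obtain ⟨X, rfl⟩ := hx; exact h X
  | algebraMap r => exact Algebra.commutes r z
  | add x y _ _ hx hy => rw [add_mul, mul_add, hx, hy]
  | mul x y _ _ hx hy => rw [mul_assoc, hy, ← mul_assoc, hx, mul_assoc]

/-- The images in the enveloping algebra of the traceless parts of the matrix units. -/
def unit : Fin 3 → Fin 3 → USu3 :=
  ![![(1 / 3 : ℂ) • ((2 : ℂ) • h₁ + h₂), L₁₂, L₄₅],
    ![Lbar₁₂, (1 / 3 : ℂ) • (h₂ - h₁), L₆₇],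
    ![Lbar₄₅, Lbar₆₇, -((1 / 3 : ℂ) • (h₁ + (2 : ℂ) • h₂))]]

/-- The complex linear extension of `su(3) → U` to all matrices that kills the scalars. -/
def ofMatrix : Matrix (Fin 3) (Fin 3) ℂ →ₗ[ℂ] USu3 where
  toFun M := ∑ i, ∑ j, M i j • unit i j
  map_add' M N := by simp only [Matrix.add_apply, add_smul, Finset.sum_add_distrib]
  map_smul' c M := by
    simp only [Matrix.smul_apply, smul_eq_mul, mul_smul, Finset.smul_sum, RingHom.id_apply]

theorem ofMatrix_apply (M : Matrix (Fin 3) (Fin 3) ℂ) :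
    ofMatrix M = ∑ i, ∑ j, M i j • unit i j := rfl

theorem ofMatrix_single (i j : Fin 3) : ofMatrix (Matrix.single i j 1) = unit i j := by
  rw [ofMatrix_apply, Finset.sum_eq_single i, Finset.sum_eq_single j]
  · simp
  · intro b _ hb; simp [hb.symm]
  · simp
  · intro b _ hb
    exact Finset.sum_eq_zero fun c _ => by simp [hb.symm]
  · simp

theorem ofMatrix_one : ofMatrix 1 = 0 := by
  simp only [ofMatrix_apply, Fin.sum_univ_three, Matrix.one_apply, unit]
  simp
  module

theorem ofLie_su3Basis (a : Fin 8) : ofLie (su3Basis a) = Complex.I • L a := by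
  rw [L, smul_smul]; simp

theorem sqrt_three_sq : ((Real.sqrt 3 : ℝ) : ℂ) * ((Real.sqrt 3 : ℝ) : ℂ) = 3 := by
  rw [← Complex.ofReal_mul, Real.mul_self_sqrt (by norm_num)]; norm_num

theorem su3_eq_sum (X : su3) : ∃ x : Fin 8 → ℝ, X = ∑ a, x a • su3Basis a := by
  obtain ⟨X, hX, hT⟩ := X
  have e := fun i j => congr_fun (congr_fun hX i) j
  have r := fun i j => congrArg Complex.re (e i j)
  have m := fun i j => congrArg Complex.im (e i j)
  have t := congrArg Complex.im hT
  simp only [Matrix.conjTranspose_apply, Matrix.neg_apply, Complex.star_def, Complex.conj_re,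
    Complex.conj_im, Complex.neg_re, Complex.neg_im] at r m
  simp only [Matrix.trace_fin_three, Complex.add_im, Complex.zero_im] at t
  have hs : Real.sqrt 3 ≠ 0 := by positivity
  -- Coordinates read off from the entries above the diagonal and from the first two diagonal
  -- entries; anti-hermiticity and the trace condition fix the rest.
  refine ⟨![(X 0 1).im, (X 0 1).re, ((X 0 0).im - (X 1 1).im) / 2, (X 0 2).im, (X 0 2).re,
    (X 1 2).im, (X 1 2).re, Real.sqrt 3 / 2 * ((X 0 0).im + (X 1 1).im)], ?_⟩
  apply Subtype.ext
  simp only [Fin.sum_univ_eight, AddMemClass.coe_add, SetLike.val_smul, su3Basis]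
  have := r 0 0; have := r 1 1; have := r 2 2
  have := r 0 1; have := r 0 2; have := r 1 2
  have := m 0 1; have := m 0 2; have := m 1 2
  ext i j
  fin_cases i <;> fin_cases j <;> apply Complex.ext <;>
    simp [gellMann] <;> (try field_simp) <;> (try rw [Real.sq_sqrt (by norm_num)]) <;> linarith

theorem ofLie_eq_ofMatrix (X : su3) : ofLie X = ofMatrix X.1 := by
  have hb : ∀ a, ofLie (su3Basis a) = ofMatrix (su3Basis a).1 := by
    intro a
    have h3 := sqrt_three_sq
    have h3' : ((Real.sqrt 3 : ℝ) : ℂ) ≠ 0 := by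
      intro h; rw [h] at h3; norm_num at h3
    rw [ofLie_su3Basis, ofMatrix_apply]
    simp only [Fin.sum_univ_three, unit, su3Basis, L₁₂, L₄₅, L₆₇, Lbar₁₂, Lbar₄₅, Lbar₆₇, h₁, h₂]
    fin_cases a <;> simp [gellMann] <;> match_scalars <;> simp <;>
      (try field_simp) <;> (try simp only [pow_two]) <;> ring_nf
  obtain ⟨x, rfl⟩ := su3_eq_sum X
  have h1 : ofLie (∑ a, x a • su3Basis a) = ∑ a, (x a : ℂ) • ofLie (su3Basis a) := by
    simp only [Fin.sum_univ_eight, ofLie_add, ofLie_smul]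
  have h2 : ((∑ a, x a • su3Basis a : su3) : Matrix (Fin 3) (Fin 3) ℂ)
      = ∑ a, (x a : ℂ) • (su3Basis a).1 := by
    simp only [Fin.sum_univ_eight, AddMemClass.coe_add, SetLike.val_smul]
    rfl
  rw [h1, h2, map_sum]
  simp only [map_smul, hb]

/-- `gl(3, ℂ) = su(3) + i su(3) + ℂ`: split the traceless part into its anti-hermitian and hermitian
halves. This is what reduces complex linear statements to `su(3)`. -/
theorem exists_decomposition (M : Matrix (Fin 3) (Fin 3) ℂ) :
    ∃ (X Y : su3) (t : ℂ), M = X.1 + Complex.I • Y.1 + t • 1 := by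
  set N : Matrix (Fin 3) (Fin 3) ℂ := M - (M.trace / 3) • 1 with hN
  have hNt : N.trace = 0 := by simp [hN]
  have hNt' : Nᴴ.trace = 0 := by rw [Matrix.trace_conjTranspose, hNt, star_zero]
  refine ⟨⟨(1 / 2 : ℂ) • (N - Nᴴ), ?_, ?_⟩, ⟨(-Complex.I / 2) • (N + Nᴴ), ?_, ?_⟩,
    M.trace / 3, ?_⟩
  · simp only [Matrix.conjTranspose_smul, Matrix.conjTranspose_sub,
      Matrix.conjTranspose_conjTranspose]
    simp [smul_sub]
  · simp [hNt, hNt']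
  · simp only [Matrix.conjTranspose_smul, Matrix.conjTranspose_add,
      Matrix.conjTranspose_conjTranspose]
    simp [add_comm, neg_div]
  · simp [hNt, hNt']
  · have : M = N + (M.trace / 3) • 1 := by simp [hN]
    conv_lhs => rw [this]
    congr 1
    simp only [smul_smul]
    rw [show Complex.I * (-Complex.I / 2) = 1 / 2 by
      linear_combination (-1 / 2 : ℂ) * Complex.I_mul_I]
    module

theorem ofMatrix_decomposition (X Y : su3) (t : ℂ) :
    ofMatrix (X.1 + Complex.I • Y.1 + t • 1) = ofLie X + Complex.I • ofLie Y := by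
  rw [map_add, map_add, map_smul, map_smul, ofMatrix_one, ofLie_eq_ofMatrix, ofLie_eq_ofMatrix,
    smul_zero, add_zero]

/-- Both sides are complex bilinear and insensitive to scalars, so the bracket relation on `su(3)`
suffices. -/
theorem ofMatrix_commutator (M N : Matrix (Fin 3) (Fin 3) ℂ) :
    ofMatrix M * ofMatrix N - ofMatrix N * ofMatrix M = ofMatrix (M * N - N * M) := by
  have key : ∀ X Y : su3, ofMatrix (X.1 * Y.1) - ofMatrix (Y.1 * X.1)
      = ofLie X * ofLie Y - ofLie Y * ofLie X := by
    intro X Y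
    rw [← ofLie_lie, ofLie_eq_ofMatrix, ← map_sub]; rfl
  obtain ⟨X, Y, t, rfl⟩ := exists_decomposition M
  obtain ⟨X', Y', t', rfl⟩ := exists_decomposition N
  rw [ofMatrix_decomposition, ofMatrix_decomposition]
  simp only [mul_add, add_mul, smul_mul_assoc, mul_smul_comm, map_add, map_sub, map_smul, mul_one,
    one_mul, ofMatrix_one]
  have e1 := key X X'
  have e2 := key X Y'
  have e3 := key Y X'
  have e4 := key Y Y'
  rw [sub_eq_iff_eq_add] at e1 e2 e3 e4
  rw [e1, e2, e3, e4]
  module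

theorem unit_mul_unit (i j k l : Fin 3) :
    unit i j * unit k l = unit k l * unit i j
      + ((if j = k then unit i l else 0) - (if l = i then unit k j else 0)) := by
  rw [← sub_eq_iff_eq_add', ← ofMatrix_single i j, ← ofMatrix_single k l, ofMatrix_commutator,
    map_sub]
  congr 1
  · split_ifs with h
    · rw [h, Matrix.single_mul_single_same, one_mul, ofMatrix_single]
    · rw [Matrix.single_mul_single_of_ne (h := h), map_zero]
  · split_ifs with h
    · rw [h, Matrix.single_mul_single_same, one_mul, ofMatrix_single]
    · rw [Matrix.single_mul_single_of_ne (h := h), map_zero]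

end USu3

/-- The commutation relations of the Chevalley basis of `sl(3)`, as rules that bring products into
the order `f₁ < f₂ < f₃ < k₁ < k₂ < e₁ < e₂ < e₃`. -/
structure ChevalleyRelations {A : Type*} [Ring A] [Algebra ℂ A]
    (f₁ f₂ f₃ k₁ k₂ e₁ e₂ e₃ : A) : Prop where
  f₂_f₁ : f₂ * f₁ = f₁ * f₂ + f₃
  f₃_f₁ : f₃ * f₁ = f₁ * f₃
  f₃_f₂ : f₃ * f₂ = f₂ * f₃
  k₁_f₁ : k₁ * f₁ = f₁ * k₁ - (2 : ℂ) • f₁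
  k₁_f₂ : k₁ * f₂ = f₂ * k₁ + f₂
  k₁_f₃ : k₁ * f₃ = f₃ * k₁ - f₃
  k₂_f₁ : k₂ * f₁ = f₁ * k₂ + f₁
  k₂_f₂ : k₂ * f₂ = f₂ * k₂ - (2 : ℂ) • f₂
  k₂_f₃ : k₂ * f₃ = f₃ * k₂ - f₃
  k₂_k₁ : k₂ * k₁ = k₁ * k₂
  e₁_f₁ : e₁ * f₁ = f₁ * e₁ + k₁
  e₁_f₂ : e₁ * f₂ = f₂ * e₁
  e₁_f₃ : e₁ * f₃ = f₃ * e₁ - f₂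
  e₁_k₁ : e₁ * k₁ = k₁ * e₁ - (2 : ℂ) • e₁
  e₁_k₂ : e₁ * k₂ = k₂ * e₁ + e₁
  e₂_f₁ : e₂ * f₁ = f₁ * e₂
  e₂_f₂ : e₂ * f₂ = f₂ * e₂ + k₂
  e₂_f₃ : e₂ * f₃ = f₃ * e₂ + f₁
  e₂_k₁ : e₂ * k₁ = k₁ * e₂ + e₂
  e₂_k₂ : e₂ * k₂ = k₂ * e₂ - (2 : ℂ) • e₂
  e₂_e₁ : e₂ * e₁ = e₁ * e₂ - e₃
  e₃_f₁ : e₃ * f₁ = f₁ * e₃ - e₂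
  e₃_f₂ : e₃ * f₂ = f₂ * e₃ + e₁
  e₃_f₃ : e₃ * f₃ = f₃ * e₃ + (k₁ + k₂)
  e₃_k₁ : e₃ * k₁ = k₁ * e₃ - e₃
  e₃_k₂ : e₃ * k₂ = k₂ * e₃ - e₃
  e₃_e₁ : e₃ * e₁ = e₁ * e₃
  e₃_e₂ : e₃ * e₂ = e₂ * e₃

/-! ### Normal ordering in a Chevalley basis -/

namespace ChevalleyRelations

/-- This and the next two lemmas give the relations in a form that rewrites inside right-associated
products, where the factors to be swapped are followed by a tail `w`. -/
theorem mul_mul_of_eq {A : Type*} [Ring A] {x y : A} (h : x * y = y * x) (w : A) :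
    x * (y * w) = y * (x * w) := by
  rw [← mul_assoc, h, mul_assoc]

theorem mul_mul_of_eq_add {A : Type*} [Ring A] {x y r : A} (h : x * y = y * x + r) (w : A) :
    x * (y * w) = y * (x * w) + r * w := by
  rw [← mul_assoc, h, add_mul, mul_assoc]

theorem mul_mul_of_eq_sub {A : Type*} [Ring A] {x y r : A} (h : x * y = y * x - r) (w : A) :
    x * (y * w) = y * (x * w) - r * w := by
  rw [← mul_assoc, h, sub_mul, mul_assoc]

variable {A : Type*} [Ring A] [Algebra ℂ A] {f₁ f₂ f₃ k₁ k₂ e₁ e₂ e₃ : A}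

/-- The quadratic Casimir element in a Chevalley basis. -/
def quadratic (f₁ f₂ f₃ k₁ k₂ e₁ e₂ e₃ : A) : A :=
  e₁ * f₁ + f₁ * e₁ + (e₂ * f₂ + f₂ * e₂) + (e₃ * f₃ + f₃ * e₃)
    + (2 / 3 : ℂ) • (k₁ * k₁ + k₂ * k₂) + (1 / 3 : ℂ) • (k₁ * k₂ + k₂ * k₁)

/-- The cubic Casimir element in a Chevalley basis. -/
def cubic (f₁ f₂ f₃ k₁ k₂ e₁ e₂ e₃ : A) : A :=
  (1 / 3 : ℂ) • (k₁ * (f₁ * e₁ + f₃ * e₃ - (2 : ℂ) • (f₂ * e₂)))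
  + (1 / 3 : ℂ) • (k₂ * ((2 : ℂ) • (f₁ * e₁) - f₃ * e₃ - f₂ * e₂))
  + f₃ * e₂ * e₁ + f₂ * f₁ * e₃
  + f₁ * e₁ - f₂ * e₂
  + (1 / 3 : ℂ) • ((1 / 3 : ℂ) • (k₂ * k₁ * k₁ - k₂ * k₂ * k₁)
      + (2 / 9 : ℂ) • (k₁ * k₁ * k₁ - k₂ * k₂ * k₂)
      + (k₁ * k₁ - k₂ * k₂) + (k₁ - k₂))

set_option linter.unusedSimpArgs false in
-- The relations rewrite both sides into ordered monomials, after which only a linear comparison of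
-- coefficients remains. The simple root vectors are enough, as they generate the algebra.
theorem quadratic_commute (h : ChevalleyRelations f₁ f₂ f₃ k₁ k₂ e₁ e₂ e₃) :
    f₁ * quadratic f₁ f₂ f₃ k₁ k₂ e₁ e₂ e₃ = quadratic f₁ f₂ f₃ k₁ k₂ e₁ e₂ e₃ * f₁ ∧
    f₂ * quadratic f₁ f₂ f₃ k₁ k₂ e₁ e₂ e₃ = quadratic f₁ f₂ f₃ k₁ k₂ e₁ e₂ e₃ * f₂ ∧
    e₁ * quadratic f₁ f₂ f₃ k₁ k₂ e₁ e₂ e₃ = quadratic f₁ f₂ f₃ k₁ k₂ e₁ e₂ e₃ * e₁ ∧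
    e₂ * quadratic f₁ f₂ f₃ k₁ k₂ e₁ e₂ e₃ = quadratic f₁ f₂ f₃ k₁ k₂ e₁ e₂ e₃ * e₂ := by
  refine ⟨?_, ?_, ?_, ?_⟩ <;>
  · simp only [quadratic, mul_add, add_mul, mul_sub, sub_mul, smul_mul_assoc, mul_smul_comm,
      mul_assoc, smul_add, smul_sub, neg_mul, mul_neg, smul_neg, h.f₂_f₁, h.f₃_f₁, h.f₃_f₂,
      h.k₁_f₁, h.k₁_f₂, h.k₁_f₃, h.k₂_f₁, h.k₂_f₂, h.k₂_f₃, h.k₂_k₁, h.e₁_f₁, h.e₁_f₂, h.e₁_f₃,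
      h.e₁_k₁, h.e₁_k₂, h.e₂_f₁, h.e₂_f₂, h.e₂_f₃, h.e₂_k₁, h.e₂_k₂, h.e₂_e₁, h.e₃_f₁, h.e₃_f₂,
      h.e₃_f₃, h.e₃_k₁, h.e₃_k₂, h.e₃_e₁, h.e₃_e₂, mul_mul_of_eq_add h.f₂_f₁,
      mul_mul_of_eq h.f₃_f₁, mul_mul_of_eq h.f₃_f₂, mul_mul_of_eq_sub h.k₁_f₁,
      mul_mul_of_eq_add h.k₁_f₂, mul_mul_of_eq_sub h.k₁_f₃, mul_mul_of_eq_add h.k₂_f₁,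
      mul_mul_of_eq_sub h.k₂_f₂, mul_mul_of_eq_sub h.k₂_f₃, mul_mul_of_eq h.k₂_k₁,
      mul_mul_of_eq_add h.e₁_f₁, mul_mul_of_eq h.e₁_f₂, mul_mul_of_eq_sub h.e₁_f₃,
      mul_mul_of_eq_sub h.e₁_k₁, mul_mul_of_eq_add h.e₁_k₂, mul_mul_of_eq h.e₂_f₁,
      mul_mul_of_eq_add h.e₂_f₂, mul_mul_of_eq_add h.e₂_f₃, mul_mul_of_eq_add h.e₂_k₁,
      mul_mul_of_eq_sub h.e₂_k₂, mul_mul_of_eq_sub h.e₂_e₁, mul_mul_of_eq_sub h.e₃_f₁,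
      mul_mul_of_eq_add h.e₃_f₂, mul_mul_of_eq_add h.e₃_f₃, mul_mul_of_eq_sub h.e₃_k₁,
      mul_mul_of_eq_sub h.e₃_k₂, mul_mul_of_eq h.e₃_e₁, mul_mul_of_eq h.e₃_e₂]
    module

set_option linter.unusedSimpArgs false in
theorem cubic_commute (h : ChevalleyRelations f₁ f₂ f₃ k₁ k₂ e₁ e₂ e₃) :
    f₁ * cubic f₁ f₂ f₃ k₁ k₂ e₁ e₂ e₃ = cubic f₁ f₂ f₃ k₁ k₂ e₁ e₂ e₃ * f₁ ∧
    f₂ * cubic f₁ f₂ f₃ k₁ k₂ e₁ e₂ e₃ = cubic f₁ f₂ f₃ k₁ k₂ e₁ e₂ e₃ * f₂ ∧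
    e₁ * cubic f₁ f₂ f₃ k₁ k₂ e₁ e₂ e₃ = cubic f₁ f₂ f₃ k₁ k₂ e₁ e₂ e₃ * e₁ ∧
    e₂ * cubic f₁ f₂ f₃ k₁ k₂ e₁ e₂ e₃ = cubic f₁ f₂ f₃ k₁ k₂ e₁ e₂ e₃ * e₂ := by
  refine ⟨?_, ?_, ?_, ?_⟩ <;>
  · simp only [cubic, mul_add, add_mul, mul_sub, sub_mul, smul_mul_assoc, mul_smul_comm,
      mul_assoc, smul_add, smul_sub, neg_mul, mul_neg, smul_neg, h.f₂_f₁, h.f₃_f₁, h.f₃_f₂,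
      h.k₁_f₁, h.k₁_f₂, h.k₁_f₃, h.k₂_f₁, h.k₂_f₂, h.k₂_f₃, h.k₂_k₁, h.e₁_f₁, h.e₁_f₂, h.e₁_f₃,
      h.e₁_k₁, h.e₁_k₂, h.e₂_f₁, h.e₂_f₂, h.e₂_f₃, h.e₂_k₁, h.e₂_k₂, h.e₂_e₁, h.e₃_f₁, h.e₃_f₂,
      h.e₃_f₃, h.e₃_k₁, h.e₃_k₂, h.e₃_e₁, h.e₃_e₂, mul_mul_of_eq_add h.f₂_f₁,
      mul_mul_of_eq h.f₃_f₁, mul_mul_of_eq h.f₃_f₂, mul_mul_of_eq_sub h.k₁_f₁,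
      mul_mul_of_eq_add h.k₁_f₂, mul_mul_of_eq_sub h.k₁_f₃, mul_mul_of_eq_add h.k₂_f₁,
      mul_mul_of_eq_sub h.k₂_f₂, mul_mul_of_eq_sub h.k₂_f₃, mul_mul_of_eq h.k₂_k₁,
      mul_mul_of_eq_add h.e₁_f₁, mul_mul_of_eq h.e₁_f₂, mul_mul_of_eq_sub h.e₁_f₃,
      mul_mul_of_eq_sub h.e₁_k₁, mul_mul_of_eq_add h.e₁_k₂, mul_mul_of_eq h.e₂_f₁,
      mul_mul_of_eq_add h.e₂_f₂, mul_mul_of_eq_add h.e₂_f₃, mul_mul_of_eq_add h.e₂_k₁,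
      mul_mul_of_eq_sub h.e₂_k₂, mul_mul_of_eq_sub h.e₂_e₁, mul_mul_of_eq_sub h.e₃_f₁,
      mul_mul_of_eq_add h.e₃_f₂, mul_mul_of_eq_add h.e₃_f₃, mul_mul_of_eq_sub h.e₃_k₁,
      mul_mul_of_eq_sub h.e₃_k₂, mul_mul_of_eq h.e₃_e₁, mul_mul_of_eq h.e₃_e₂]
    module

set_option linter.unusedSimpArgs false in
/-- The cubic Casimir element is unchanged when every product is reversed and `fᵢ`, `eᵢ` are
exchanged. -/
theorem cubic_reverse (h : ChevalleyRelations f₁ f₂ f₃ k₁ k₂ e₁ e₂ e₃) :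
    (1 / 3 : ℂ) • ((f₁ * e₁ + f₃ * e₃ - (2 : ℂ) • (f₂ * e₂)) * k₁)
    + (1 / 3 : ℂ) • (((2 : ℂ) • (f₁ * e₁) - f₃ * e₃ - f₂ * e₂) * k₂)
    + f₁ * (f₂ * e₃) + f₃ * (e₁ * e₂)
    + f₁ * e₁ - f₂ * e₂
    + (1 / 3 : ℂ) • ((1 / 3 : ℂ) • (k₁ * (k₁ * k₂) - k₁ * (k₂ * k₂))
        + (2 / 9 : ℂ) • (k₁ * (k₁ * k₁) - k₂ * (k₂ * k₂))
        + (k₁ * k₁ - k₂ * k₂) + (k₁ - k₂)) =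
    cubic f₁ f₂ f₃ k₁ k₂ e₁ e₂ e₃ := by
  simp only [cubic, mul_add, add_mul, mul_sub, sub_mul, smul_mul_assoc, mul_smul_comm,
    mul_assoc, smul_add, smul_sub, neg_mul, mul_neg, smul_neg, h.f₂_f₁, h.f₃_f₁, h.f₃_f₂,
    h.k₁_f₁, h.k₁_f₂, h.k₁_f₃, h.k₂_f₁, h.k₂_f₂, h.k₂_f₃, h.k₂_k₁, h.e₁_f₁, h.e₁_f₂, h.e₁_f₃,
    h.e₁_k₁, h.e₁_k₂, h.e₂_f₁, h.e₂_f₂, h.e₂_f₃, h.e₂_k₁, h.e₂_k₂, h.e₂_e₁, h.e₃_f₁, h.e₃_f₂,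
    h.e₃_f₃, h.e₃_k₁, h.e₃_k₂, h.e₃_e₁, h.e₃_e₂, mul_mul_of_eq_add h.f₂_f₁,
    mul_mul_of_eq h.f₃_f₁, mul_mul_of_eq h.f₃_f₂, mul_mul_of_eq_sub h.k₁_f₁,
    mul_mul_of_eq_add h.k₁_f₂, mul_mul_of_eq_sub h.k₁_f₃, mul_mul_of_eq_add h.k₂_f₁,
    mul_mul_of_eq_sub h.k₂_f₂, mul_mul_of_eq_sub h.k₂_f₃, mul_mul_of_eq h.k₂_k₁,
    mul_mul_of_eq_add h.e₁_f₁, mul_mul_of_eq h.e₁_f₂, mul_mul_of_eq_sub h.e₁_f₃,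
    mul_mul_of_eq_sub h.e₁_k₁, mul_mul_of_eq_add h.e₁_k₂, mul_mul_of_eq h.e₂_f₁,
    mul_mul_of_eq_add h.e₂_f₂, mul_mul_of_eq_add h.e₂_f₃, mul_mul_of_eq_add h.e₂_k₁,
    mul_mul_of_eq_sub h.e₂_k₂, mul_mul_of_eq_sub h.e₂_e₁, mul_mul_of_eq_sub h.e₃_f₁,
    mul_mul_of_eq_add h.e₃_f₂, mul_mul_of_eq_add h.e₃_f₃, mul_mul_of_eq_sub h.e₃_k₁,
    mul_mul_of_eq_sub h.e₃_k₂, mul_mul_of_eq h.e₃_e₁, mul_mul_of_eq h.e₃_e₂]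
  module

end ChevalleyRelations

/-! ### Centrality of the Casimir elements and the scalar on irreducible representations -/

namespace USu3

theorem chevalleyRelations_unit : ChevalleyRelations (unit 1 0) (unit 2 1) (unit 2 0)
    (unit 0 0 - unit 1 1) (unit 1 1 - unit 2 2) (unit 0 1) (unit 1 2) (unit 0 2) where
  f₂_f₁ := by
    rw [unit_mul_unit 2 1 1 0]
    simp
    try module
  f₃_f₁ := by
    rw [unit_mul_unit 2 0 1 0]
    simp
    try module
  f₃_f₂ := by
    rw [unit_mul_unit 2 0 2 1]
    simp
    try module
  k₁_f₁ := by
    simp only [sub_mul, mul_sub]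
    rw [unit_mul_unit 0 0 1 0, unit_mul_unit 1 1 1 0]
    simp
    try module
  k₁_f₂ := by
    simp only [sub_mul, mul_sub]
    rw [unit_mul_unit 0 0 2 1, unit_mul_unit 1 1 2 1]
    simp
    try module
  k₁_f₃ := by
    simp only [sub_mul, mul_sub]
    rw [unit_mul_unit 0 0 2 0, unit_mul_unit 1 1 2 0]
    simp
    try module
  k₂_f₁ := by
    simp only [sub_mul, mul_sub]
    rw [unit_mul_unit 1 1 1 0, unit_mul_unit 2 2 1 0]
    simp
    try module
  k₂_f₂ := by
    simp only [sub_mul, mul_sub]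
    rw [unit_mul_unit 1 1 2 1, unit_mul_unit 2 2 2 1]
    simp
    try module
  k₂_f₃ := by
    simp only [sub_mul, mul_sub]
    rw [unit_mul_unit 1 1 2 0, unit_mul_unit 2 2 2 0]
    simp
    try module
  k₂_k₁ := by
    simp only [sub_mul, mul_sub]
    rw [unit_mul_unit 1 1 0 0, unit_mul_unit 1 1 1 1, unit_mul_unit 2 2 0 0, unit_mul_unit 2 2 1 1]
    simp
    try module
  e₁_f₁ := by
    rw [unit_mul_unit 0 1 1 0]
    simp
    try module
  e₁_f₂ := by
    rw [unit_mul_unit 0 1 2 1]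
    simp
    try module
  e₁_f₃ := by
    rw [unit_mul_unit 0 1 2 0]
    simp
    try module
  e₁_k₁ := by
    simp only [sub_mul, mul_sub]
    rw [unit_mul_unit 0 1 0 0, unit_mul_unit 0 1 1 1]
    simp
    try module
  e₁_k₂ := by
    simp only [sub_mul, mul_sub]
    rw [unit_mul_unit 0 1 1 1, unit_mul_unit 0 1 2 2]
    simp
    try module
  e₂_f₁ := by
    rw [unit_mul_unit 1 2 1 0]
    simp
    try module
  e₂_f₂ := by
    rw [unit_mul_unit 1 2 2 1]
    simp
    try module
  e₂_f₃ := by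
    rw [unit_mul_unit 1 2 2 0]
    simp
    try module
  e₂_k₁ := by
    simp only [sub_mul, mul_sub]
    rw [unit_mul_unit 1 2 0 0, unit_mul_unit 1 2 1 1]
    simp
    try module
  e₂_k₂ := by
    simp only [sub_mul, mul_sub]
    rw [unit_mul_unit 1 2 1 1, unit_mul_unit 1 2 2 2]
    simp
    try module
  e₂_e₁ := by
    rw [unit_mul_unit 1 2 0 1]
    simp
    try module
  e₃_f₁ := by
    rw [unit_mul_unit 0 2 1 0]
    simp
    try module
  e₃_f₂ := by
    rw [unit_mul_unit 0 2 2 1]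
    simp
    try module
  e₃_f₃ := by
    rw [unit_mul_unit 0 2 2 0]
    simp
    try module
  e₃_k₁ := by
    simp only [sub_mul, mul_sub]
    rw [unit_mul_unit 0 2 0 0, unit_mul_unit 0 2 1 1]
    simp
    try module
  e₃_k₂ := by
    simp only [sub_mul, mul_sub]
    rw [unit_mul_unit 0 2 1 1, unit_mul_unit 0 2 2 2]
    simp
    try module
  e₃_e₁ := by
    rw [unit_mul_unit 0 2 0 1]
    simp
    try module
  e₃_e₂ := by
    rw [unit_mul_unit 0 2 1 2]
    simp
    try module

theorem unit_sub_unit_eq_h₁ : unit 0 0 - unit 1 1 = h₁ := by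
  simp only [unit]
  simp
  module

theorem unit_sub_unit_eq_h₂ : unit 1 1 - unit 2 2 = h₂ := by
  simp only [unit]
  simp
  module

theorem chevalleyRelations : ChevalleyRelations Lbar₁₂ Lbar₆₇ Lbar₄₅ h₁ h₂ L₁₂ L₆₇ L₄₅ := by
  have h := chevalleyRelations_unit
  rwa [unit_sub_unit_eq_h₁, unit_sub_unit_eq_h₂] at h

/-- The centralizer of `z` is a subalgebra, and brackets of the simple root vectors produce the
remaining root vectors and the coroots. -/
theorem mem_center_of_commute {z : USu3} (h1 : Lbar₁₂ * z = z * Lbar₁₂)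
    (h2 : Lbar₆₇ * z = z * Lbar₆₇) (h3 : L₁₂ * z = z * L₁₂) (h4 : L₆₇ * z = z * L₆₇) :
    z ∈ Subalgebra.center ℂ USu3 := by
  apply mem_center_of_commute_ofLie
  set S := Subalgebra.centralizer ℂ ({z} : Set USu3)
  have hS : ∀ {x : USu3}, x ∈ S ↔ x * z = z * x := by
    intro x
    rw [Subalgebra.mem_centralizer_iff]
    simp [eq_comm]
  have r := chevalleyRelations
  rw [← hS] at h1 h2 h3 h4
  have h5 : Lbar₄₅ ∈ S := by
    rw [← sub_eq_of_eq_add' r.f₂_f₁]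
    exact sub_mem (mul_mem h2 h1) (mul_mem h1 h2)
  have h6 : L₄₅ ∈ S := by
    rw [← sub_sub_self (L₁₂ * L₆₇) L₄₅, ← r.e₂_e₁]
    exact sub_mem (mul_mem h3 h4) (mul_mem h4 h3)
  have h7 : h₁ ∈ S := by
    rw [← sub_eq_of_eq_add' r.e₁_f₁]
    exact sub_mem (mul_mem h3 h1) (mul_mem h1 h3)
  have h8 : h₂ ∈ S := by
    rw [← sub_eq_of_eq_add' r.e₂_f₂]
    exact sub_mem (mul_mem h4 h2) (mul_mem h2 h4)
  have hu : ∀ i j, unit i j ∈ S := by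
    intro i j
    fin_cases i <;> fin_cases j
    · exact S.smul_mem (add_mem (S.smul_mem h7 _) h8) _
    · exact h3
    · exact h6
    · exact h1
    · exact S.smul_mem (sub_mem h8 h7) _
    · exact h4
    · exact h5
    · exact h2
    · exact neg_mem (S.smul_mem (add_mem h7 (S.smul_mem h8 _)) _)
  intro X
  rw [← hS, ofLie_eq_ofMatrix, ofMatrix_apply]
  exact sum_mem fun i _ => sum_mem fun j _ => S.smul_mem (hu i j) _

theorem sqrt_two_inv_sq : ((1 / Real.sqrt 2 : ℝ) : ℂ) * ((1 / Real.sqrt 2 : ℝ) : ℂ) = 1 / 2 := by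
  rw [← Complex.ofReal_mul, div_mul_div_comm, Real.mul_self_sqrt (by norm_num)]
  norm_num

theorem Ω₂hat_eq_sum : Ω₂hat = ∑ a, (1 / 2 : ℂ) • (L a * L a) := by
  rw [Ω₂hat, ← Finset.sum_neg_distrib]
  refine Finset.sum_congr rfl fun a _ => ?_
  rw [Xhat, ofLie_su3Basis, smul_mul_smul_comm, smul_mul_smul_comm, sqrt_two_inv_sq,
    Complex.I_mul_I, ← smul_neg]
  simp

theorem h₂_eq : h₂ = (1 / 2 : ℂ) • (((Real.sqrt 3 : ℝ) : ℂ) • L 7 - L 2) := by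
  rw [h₂, sub_eq_add_neg, add_comm]

/-- Both sides are symmetrised, so the cross terms cancel as noncommutative polynomials in the `L
a`; no commutation relation enters. -/
theorem Ω₂hat_eq_quadratic :
    Ω₂hat = ChevalleyRelations.quadratic Lbar₁₂ Lbar₆₇ Lbar₄₅ h₁ h₂ L₁₂ L₆₇ L₄₅ := by
  have h3 := sqrt_three_sq
  rw [Ω₂hat_eq_sum]
  simp only [ChevalleyRelations.quadratic, Fin.sum_univ_eight, Lbar₁₂, Lbar₆₇, Lbar₄₅, h₁,
    h₂_eq, L₁₂, L₆₇, L₄₅, mul_add, add_mul, mul_sub, sub_mul, smul_mul_assoc, mul_smul_comm,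
    smul_add, smul_sub, smul_smul]
  match_scalars <;>
    first
    | ring1
    | linear_combination (1 / 2 : ℂ) * Complex.I_mul_I
    | linear_combination (-1 / 2 : ℂ) * Complex.I_mul_I
    | linear_combination (-1 / 6 : ℂ) * h3

theorem Ω₃_mem_center : Ω₃ ∈ Subalgebra.center ℂ USu3 := by
  -- `Ω₃` is `cubic` at the Chevalley generators by definition.
  obtain ⟨h1, h2, h3, h4⟩ := chevalleyRelations.cubic_commute
  exact mem_center_of_commute h1 h2 h3 h4

theorem Ω₂hat_mem_center : Ω₂hat ∈ Subalgebra.center ℂ USu3 := by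
  obtain ⟨h1, h2, h3, h4⟩ := chevalleyRelations.quadratic_commute
  rw [← Ω₂hat_eq_quadratic] at h1 h2 h3 h4
  exact mem_center_of_commute h1 h2 h3 h4

/-- All monomials with root vectors end in a raising operator and annihilate `v`; the remaining
polynomial in the coroots factors as displayed. -/
theorem eval_Ω₃_apply_highestWeight {V : Type*} [AddCommGroup V] [Module ℂ V]
    (ρ : su3 →ₗ⁅ℝ⁆ Module.End ℂ V) (o₁ o₂ : ℂ) (v : V) (h12 : eval ρ L₁₂ v = 0)
    (h45 : eval ρ L₄₅ v = 0) (h67 : eval ρ L₆₇ v = 0) (hh1 : eval ρ h₁ v = o₁ • v)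
    (hh2 : eval ρ h₂ v = o₂ • v) :
    eval ρ Ω₃ v = ((o₁ - o₂) * (3 + 2 * o₁ + o₂) * (3 + o₁ + 2 * o₂) / 27 : ℂ) • v := by
  simp only [Ω₃, map_add, map_sub, map_mul, map_smul, LinearMap.add_apply, LinearMap.sub_apply,
    LinearMap.smul_apply, Module.End.mul_apply, h12, h45, h67, hh1, hh2, map_zero]
  module

/-- By centrality the eigenspace of `Ω₃` for this value is invariant, and it contains the highest
weight vector, so it is everything. No finiteness of dimension is needed. -/
theorem eval_Ω₃_of_isIrrepOfHighestWeight {V : Type*} [AddCommGroup V] [Module ℂ V]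
    {ρ : su3 →ₗ⁅ℝ⁆ Module.End ℂ V} {o₁ o₂ : ℕ} (h : IsIrrepOfHighestWeight ρ o₁ o₂) (v : V) :
    eval ρ Ω₃ v = ((o₁ - o₂) * (3 + 2 * o₁ + o₂) * (3 + o₁ + 2 * o₂) / 27 : ℂ) • v := by
  obtain ⟨w, hw, h12, h45, h67, hh1, hh2⟩ := h.highestWeight
  set c : ℂ := (o₁ - o₂) * (3 + 2 * o₁ + o₂) * (3 + o₁ + 2 * o₂) / 27
  have hwc : eval ρ Ω₃ w = c • w := eval_Ω₃_apply_highestWeight ρ o₁ o₂ w h12 h45 h67 hh1 hh2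
  rcases h.irreducible (Module.End.eigenspace (eval ρ Ω₃) c) (fun X x hx => by
    rw [Module.End.mem_eigenspace_iff] at hx ⊢
    have hc := congrArg (eval ρ) (Subalgebra.mem_center_iff.1 Ω₃_mem_center (ofLie X))
    rw [map_mul, map_mul, eval_ofLie] at hc
    have := LinearMap.congr_fun hc x
    rw [Module.End.mul_apply, Module.End.mul_apply, hx, map_smul] at this
    exact this.symm) with hbot | htop
  · have : w ∈ Module.End.eigenspace (eval ρ Ω₃) c := Module.End.mem_eigenspace_iff.2 hwc
    rw [hbot, Submodule.mem_bot] at this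
    exact absurd this hw
  · have : v ∈ Module.End.eigenspace (eval ρ Ω₃) c := by rw [htop]; trivial
    exact Module.End.mem_eigenspace_iff.1 this

/-! ### Constant terms and hermitian conjugation -/

theorem constTerm_L (a : Fin 8) : constTerm (L a) = 0 := by
  rw [L, map_smul, constTerm_ofLie, smul_zero]

theorem constTerm_Ω₂hat : constTerm Ω₂hat = 0 := by
  simp only [Ω₂hat_eq_sum, map_sum, map_smul, map_mul, constTerm_L, mul_zero, smul_zero,
    Finset.sum_const_zero]

theorem constTerm_Ω₃ : constTerm Ω₃ = 0 := by
  simp only [Ω₃, L₁₂, L₄₅, L₆₇, Lbar₁₂, Lbar₄₅, Lbar₆₇, h₁, h₂, map_add, map_sub, map_mul,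
    map_smul, map_neg, constTerm_L]
  simp

theorem adj_mul (x y : USu3) : adj (x * y) = adj y * adj x := by
  induction x using TensorProduct.induction_on with
  | zero => simp only [zero_mul, map_zero, mul_zero]
  | add x x' hx hx' => rw [add_mul, map_add, map_add, mul_add, hx, hx']
  | tmul c u =>
    induction y using TensorProduct.induction_on with
    | zero => simp only [zero_mul, map_zero, mul_zero]
    | add y y' hy hy' => rw [mul_add, map_add, map_add, add_mul, hy, hy']
    | tmul d w =>
      simp only [adj, Algebra.TensorProduct.tmul_mul_tmul, TensorProduct.map_tmul,
        LinearMap.comp_apply, AlgHom.toLinearMap_apply, LinearEquiv.coe_coe, map_mul]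
      congr 1
      simp [mul_comm]

theorem adj_smul (c : ℂ) (x : USu3) : adj (c • x) = star c • adj x := by
  induction x using TensorProduct.induction_on with
  | zero => simp only [smul_zero, map_zero]
  | add x y hx hy => rw [smul_add, map_add, map_add, smul_add, hx, hy]
  | tmul d w =>
    rw [TensorProduct.smul_tmul', smul_eq_mul]
    simp only [adj, TensorProduct.map_tmul, TensorProduct.smul_tmul', smul_eq_mul]
    congr 1
    simp

theorem adj_ofLie (X : su3) : adj (ofLie X) = -ofLie X := by
  simp only [adj, ofLie, TensorProduct.map_tmul, LinearMap.comp_apply, AlgHom.toLinearMap_apply,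
    antipode, UniversalEnvelopingAlgebra.lift_ι_apply]
  rw [← TensorProduct.tmul_neg]
  congr 1
  simp

theorem adj_L (a : Fin 8) : adj (L a) = L a := by
  rw [L, adj_smul, adj_ofLie]
  simp

theorem adj_Ω₂hat : adj Ω₂hat = Ω₂hat := by
  rw [Ω₂hat_eq_sum, map_sum]
  refine Finset.sum_congr rfl fun a _ => ?_
  rw [adj_smul, adj_mul, adj_L]
  simp

theorem adj_h₁ : adj h₁ = h₁ := adj_L 2

theorem adj_h₂ : adj h₂ = h₂ := by
  rw [h₂, adj_smul, map_add, map_neg, adj_smul, adj_L, adj_L]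
  simp [Complex.conj_ofReal]

theorem adj_lowering (a b : Fin 8) :
    adj ((1 / 2 : ℂ) • (L a - Complex.I • L b)) = (1 / 2 : ℂ) • (L a + Complex.I • L b) := by
  rw [adj_smul, map_sub, adj_smul, adj_L, adj_L]
  simp

theorem adj_raising (a b : Fin 8) :
    adj ((1 / 2 : ℂ) • (L a + Complex.I • L b)) = (1 / 2 : ℂ) • (L a - Complex.I • L b) := by
  rw [adj_smul, map_add, adj_smul, adj_L, adj_L]
  simp [sub_eq_add_neg]

theorem adj_Ω₃ : adj Ω₃ = Ω₃ := by
  have e1 : adj L₁₂ = Lbar₁₂ := adj_raising 0 1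
  have e2 : adj L₆₇ = Lbar₆₇ := adj_raising 5 6
  have e3 : adj L₄₅ = Lbar₄₅ := adj_raising 3 4
  have f1 : adj Lbar₁₂ = L₁₂ := adj_lowering 0 1
  have f2 : adj Lbar₆₇ = L₆₇ := adj_lowering 5 6
  have f3 : adj Lbar₄₅ = L₄₅ := adj_lowering 3 4
  have s1 : star (1 / 3 : ℂ) = 1 / 3 := by simp
  have s2 : star (2 / 9 : ℂ) = 2 / 9 := by simp
  have s3 : star (2 : ℂ) = 2 := by simp
  refine Eq.trans ?_ chevalleyRelations.cubic_reverse
  simp only [Ω₃, map_add, map_sub, adj_smul, adj_mul, adj_h₁, adj_h₂, e1, e2, e3, f1, f2, f3,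
    s1, s2, s3]

end USu3

/-! ### Invariant symmetric forms on `sl(3)` of degree one, two and three -/

namespace InvariantTensor

/-- A linear form on `3 × 3` matrices, given by its values `s i j` on the matrix units, that is
invariant under conjugation and vanishes on scalars is zero. -/
theorem linear_eq_zero {s : Fin 3 → Fin 3 → ℂ} (htr : s 0 0 + s 1 1 + s 2 2 = 0)
    (hinv : ∀ p q i j, (if j = p then s i q else 0) - (if q = i then s p j else 0) = 0)
    (i j : Fin 3) : s i j = 0 := by
  -- These make the diagonal values equal; the trace condition then kills them.
  have h01 := hinv 0 1 1 0
  have h12 := hinv 1 2 2 1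
  simp only [if_true] at h01 h12
  by_cases hij : i = j
  · subst hij
    fin_cases i <;> simp only [Fin.isValue, Fin.zero_eta, Fin.mk_one, Fin.reduceFinMk] <;>
      grind
  · have := hinv j j i j
    simpa [Ne.symm hij] using this

end InvariantTensor
namespace InvariantTensor

/-- A symmetric bilinear form on `3 × 3` matrices that is invariant under conjugation, has the
scalars in its kernel and vanishes on the pair of matrix units `E₀₁`, `E₁₀` is zero. -/
theorem bilinear_eq_zero {s : Fin 3 → Fin 3 → Fin 3 → Fin 3 → ℂ}
    (hs : ∀ i j k l, s i j k l = s k l i j)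
    (htr : ∀ k l, s 0 0 k l + s 1 1 k l + s 2 2 k l = 0)
    (hinv : ∀ p q i j k l,
      ((if j = p then s i q k l else 0) - (if q = i then s p j k l else 0)) +
      ((if l = p then s i j k q else 0) - (if q = k then s i j p l else 0)) = 0)
    (h0 : s 0 1 1 0 = 0) (i j k l : Fin 3) : s i j k l = 0 := by
  have a : ∀ i j k : Fin 3, i ≠ j → j ≠ k → i ≠ k → s j j k k = s i i k k := by
    intro i j k hij hjk hik
    have := hinv i j j i k k
    simp [hjk, hik.symm] at this
    linear_combination this
  have b : ∀ i j : Fin 3, i ≠ j → s j i i j = s i i i i - s j j i i := by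
    intro i j hij
    have := hinv i j j i i i
    simp [hij.symm] at this
    linear_combination this
  have hd : ∀ i k, s i i k k = 0 := by
    have a1 := a 0 1 2 (by decide) (by decide) (by decide)
    have a2 := a 0 2 1 (by decide) (by decide) (by decide)
    have a3 := a 1 2 0 (by decide) (by decide) (by decide)
    have b1 := b 0 1 (by decide)
    have t0 := htr 0 0
    have t1 := htr 1 1
    have t2 := htr 2 2
    have s1 := hs 0 0 1 1
    have s2 := hs 0 0 2 2
    have s3 := hs 1 1 2 2
    have s4 := hs 0 1 1 0
    intro i k
    fin_cases i <;> fin_cases k <;>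
      simp only [Fin.isValue, Fin.zero_eta, Fin.mk_one, Fin.reduceFinMk] <;> grind
  have he : ∀ i j, s j i i j = 0 := by
    intro i j
    by_cases hij : i = j
    · subst hij; exact hd i i
    · rw [b i j hij, hd, hd, sub_zero]
  by_contra hne
  -- The diagonal unit `E p p` acts on `s i j k l` by an integer weight. A nonzero value has weight
  -- zero, so the column indices are a permutation of the row indices.
  have hw : ∀ p, (if j = p then (1 : ℤ) else 0) - (if p = i then 1 else 0) +
      ((if l = p then 1 else 0) - (if p = k then 1 else 0)) = 0 := by
    intro p
    have := hinv p p i j k l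
    have h2 : ((((if j = p then (1 : ℤ) else 0) - (if p = i then 1 else 0) +
      ((if l = p then 1 else 0) - (if p = k then 1 else 0)) : ℤ) : ℂ)) * s i j k l = 0 := by
      rw [← this]
      push_cast
      split_ifs <;> subst_vars <;> ring
    exact_mod_cast (mul_eq_zero.1 h2).resolve_right hne
  have key : ∀ i j k l : Fin 3, (∀ p, (if j = p then (1 : ℤ) else 0) - (if p = i then 1 else 0) +
      ((if l = p then 1 else 0) - (if p = k then 1 else 0)) = 0) →
      (j = i ∧ l = k) ∨ (j = k ∧ l = i) := by decide
  rcases key i j k l hw with ⟨rfl, rfl⟩ | ⟨rfl, rfl⟩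
  · exact hne (hd _ _)
  · exact hne (he _ _)

/-- A symmetric trilinear form on `3 × 3` matrices that is invariant under conjugation, has the
scalars in its kernel and vanishes on the matrix units `E₀₁`, `E₁₂`, `E₂₀` is zero. -/
theorem trilinear_eq_zero {s : Fin 3 → Fin 3 → Fin 3 → Fin 3 → Fin 3 → Fin 3 → ℂ}
    (hs : ∀ i j k l m n, s i j k l m n = s k l i j m n)
    (hs' : ∀ i j k l m n, s i j k l m n = s i j m n k l)
    (htr : ∀ k l m n, s 0 0 k l m n + s 1 1 k l m n + s 2 2 k l m n = 0)
    (hinv : ∀ p q i j k l m n,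
      ((if j = p then s i q k l m n else 0) - (if q = i then s p j k l m n else 0)) +
      ((if l = p then s i j k q m n else 0) - (if q = k then s i j p l m n else 0)) +
      ((if n = p then s i j k l m q else 0) - (if q = m then s i j k l p n else 0)) = 0)
    (h0 : s 0 1 1 2 2 0 = 0) (i j k l m n : Fin 3) : s i j k l m n = 0 := by
  -- Invariance under `E i j` at suitable weights: `a` compares diagonal values, `b` and `c` express
  -- transposition patterns through diagonal ones, and `d` expresses 3-cycle patterns through
  -- transpositions.
  have a : ∀ i j k : Fin 3, i ≠ j → j ≠ k → i ≠ k → s j j k k k k = s i i k k k k := by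
    intro i j k hij hjk hik
    have := hinv i j j i k k k k
    simp [hjk, hik.symm] at this
    linear_combination this
  have b : ∀ i j k : Fin 3, i ≠ j → j ≠ k → i ≠ k →
      s j i k k i j = s i i k k i i - s j j k k i i := by
    intro i j k hij hjk hik
    have := hinv i j j i k k i i
    simp [hjk, hij.symm, hik.symm] at this
    linear_combination this
  have c : ∀ i j : Fin 3, i ≠ j → 2 * s j i i i i j = s i i i i i i - s j j i i i i := by
    intro i j hij
    have := hinv i j j i i i i i
    simp [hij.symm] at this
    linear_combination this + hs' j i i i i j
  have d : ∀ i j k : Fin 3, i ≠ j → j ≠ k → i ≠ k →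
      s i j j k k i = s j k j j k j - s i k j j k i := by
    intro i j k hij hjk hik
    have := hinv i j j k k i j j
    simp [hjk, hij.symm, hik.symm] at this
    linear_combination -this + hs' i k j j k i - hs' j k j j k j + hs i j j k k i + hs' j k i j k i
  -- Symmetry leaves ten diagonal values. By `a` and the trace relations all are multiples of one
  -- number `x`; the chain `d1`, `b1`, `c1` turns `h0` into a nonzero multiple of `x`.
  have hd : ∀ i k m, s i i k k m m = 0 := by
    have a1 := a 0 1 2 (by decide) (by decide) (by decide)
    have a2 := a 0 2 1 (by decide) (by decide) (by decide)
    have a3 := a 1 2 0 (by decide) (by decide) (by decide)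
    have d1 := d 0 1 2 (by decide) (by decide) (by decide)
    have b1 := b 2 0 1 (by decide) (by decide) (by decide)
    have c1 := c 1 2 (by decide)
    have e1 := hs 1 2 1 1 2 1
    have e2 := hs' 1 1 1 2 2 1
    have e3 := hs 1 1 2 1 1 2
    have t0 := htr 0 0
    have t1 := htr 1 1
    have t2 := htr 2 2
    have u := fun i k m => hs i i k k m m
    have u' := fun i k m => hs' i i k k m m
    have t00 := t0 0 0
    have t01 := t0 1 1
    have t02 := t0 2 2
    have t11 := t1 1 1
    have t12 := t1 2 2
    have t22 := t2 2 2
    have v1 : s 1 1 0 0 0 0 = s 0 0 0 0 1 1 := by rw [u, u']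
    have v2 : s 2 2 0 0 0 0 = s 0 0 0 0 2 2 := by rw [u, u']
    have v3 : s 1 1 0 0 1 1 = s 0 0 1 1 1 1 := by rw [u]
    have v4 : s 2 2 0 0 1 1 = s 0 0 1 1 2 2 := by rw [u, u']
    have v5 : s 1 1 0 0 2 2 = s 0 0 1 1 2 2 := by rw [u]
    have v6 : s 2 2 0 0 2 2 = s 0 0 2 2 2 2 := by rw [u]
    have v7 : s 2 2 1 1 1 1 = s 1 1 1 1 2 2 := by rw [u, u']
    have v8 : s 2 2 1 1 2 2 = s 1 1 2 2 2 2 := by rw [u]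
    have v9 : s 0 0 1 1 0 0 = s 0 0 0 0 1 1 := by rw [u']
    have z1 : s 0 0 0 0 1 1 = 0 := by grind
    have z2 : s 0 0 0 0 2 2 = 0 := by grind
    have z3 : s 0 0 1 1 1 1 = 0 := by grind
    have z4 : s 0 0 2 2 2 2 = 0 := by grind
    have z5 : s 0 0 1 1 2 2 = 0 := by grind
    have z6 : s 0 0 0 0 0 0 = 0 := by grind
    have z7 : s 1 1 1 1 1 1 = 0 := by grind
    have z8 : s 1 1 1 1 2 2 = 0 := by grind
    have z9 : s 1 1 2 2 2 2 = 0 := by grind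
    have z10 : s 2 2 2 2 2 2 = 0 := by grind
    intro i k m
    fin_cases i <;> fin_cases k <;> fin_cases m <;>
      simp only [Fin.isValue, Fin.zero_eta, Fin.mk_one, Fin.reduceFinMk] <;> grind
  have he : ∀ i j k, s j i k k i j = 0 := by
    intro i j k
    by_cases hij : i = j
    · subst hij; exact hd i k i
    by_cases hik : k = i
    · subst hik
      have := c k j hij
      rw [hd, hd, sub_zero] at this
      simpa using this
    by_cases hjk : k = j
    · subst hjk
      have := c k i hik
      rw [hd, hd, sub_zero] at this
      rw [hs', hs, hs']
      simpa using this
    rw [b i j k hij (Ne.symm hjk) (Ne.symm hik), hd, hd, sub_zero]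
  have hf : ∀ i j k, s i j j k k i = 0 := by
    intro i j k
    by_cases hij : i = j
    · subst hij
      rw [hs]; exact he _ _ _
    by_cases hjk : j = k
    · subst hjk
      exact he _ _ _
    by_cases hik : i = k
    · subst hik
      rw [hs']; exact he _ _ _
    rw [d i j k hij hjk hik, he, he, sub_zero]
  by_contra hne
  have hw : ∀ p, (if j = p then (1 : ℤ) else 0) - (if p = i then 1 else 0) +
      ((if l = p then 1 else 0) - (if p = k then 1 else 0)) +
      ((if n = p then 1 else 0) - (if p = m then 1 else 0)) = 0 := by
    intro p
    have := hinv p p i j k l m n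
    have h2 : ((((if j = p then (1 : ℤ) else 0) - (if p = i then 1 else 0) +
      ((if l = p then 1 else 0) - (if p = k then 1 else 0)) +
      ((if n = p then 1 else 0) - (if p = m then 1 else 0)) : ℤ) : ℂ)) * s i j k l m n = 0 := by
      rw [← this]
      push_cast
      split_ifs <;> subst_vars <;> ring
    exact_mod_cast (mul_eq_zero.1 h2).resolve_right hne
  have key : ∀ i j k l m n : Fin 3,
      (∀ p, (if j = p then (1 : ℤ) else 0) - (if p = i then 1 else 0) +
      ((if l = p then 1 else 0) - (if p = k then 1 else 0)) +
      ((if n = p then 1 else 0) - (if p = m then 1 else 0)) = 0) →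
      (j = i ∧ l = k ∧ n = m) ∨ (j = i ∧ l = m ∧ n = k) ∨ (j = k ∧ l = i ∧ n = m) ∨
      (j = m ∧ l = k ∧ n = i) ∨ (j = k ∧ l = m ∧ n = i) ∨ (j = m ∧ l = i ∧ n = k) := by decide
  rcases key i j k l m n hw with ⟨rfl, rfl, rfl⟩ | ⟨rfl, rfl, rfl⟩ | ⟨rfl, rfl, rfl⟩ |
    ⟨rfl, rfl, rfl⟩ | ⟨rfl, rfl, rfl⟩ | ⟨rfl, rfl, rfl⟩
  · exact hne (hd _ _ _)
  · exact hne (by rw [hs]; exact he _ _ _)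
  · exact hne (by rw [hs']; exact he _ _ _)
  · exact hne (he _ _ _)
  · exact hne (hf _ _ _)
  · exact hne (by rw [hs']; exact hf _ _ _)

end InvariantTensor

/-! ### The degree filtration -/

namespace USu3

theorem degreeLE_mono {m n : ℕ} (h : m ≤ n) : degreeLE m ≤ degreeLE n :=
  Submodule.span_mono fun _ ⟨l, hl, hz⟩ => ⟨l, hl.trans h, hz⟩

/-- The total degree is a separate variable, with the equation closed by `rfl` by default, so that
numerals such as `1 + 1` and `2` need no rewriting. -/
theorem mul_mem_degreeLE {m n k : ℕ} {x y : USu3} (hx : x ∈ degreeLE m) (hy : y ∈ degreeLE n)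
    (hk : m + n = k := by rfl) : x * y ∈ degreeLE k := by
  subst hk
  have h : degreeLE m * degreeLE n ≤ degreeLE (m + n) := by
    rw [degreeLE, degreeLE, Submodule.span_mul_span, Submodule.span_le]
    rintro _ ⟨_, ⟨l, hl, rfl⟩, _, ⟨l', hl', rfl⟩, rfl⟩
    refine Submodule.subset_span ⟨l ++ l', ?_, ?_⟩
    · rw [List.length_append]; omega
    · simp
  exact h (Submodule.mul_mem_mul hx hy)

theorem ofLie_mem_degreeLE (X : su3) : ofLie X ∈ degreeLE 1 :=
  Submodule.subset_span ⟨[X], by simp, by simp⟩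

theorem mem_degreeLE_zero {z : USu3} (hz : z ∈ degreeLE 0) : ∃ c : ℂ, z = algebraMap ℂ USu3 c := by
  have h : degreeLE 0 = Submodule.span ℂ {1} := by
    rw [degreeLE]
    congr 1
    ext x
    simp
  rw [h, Submodule.mem_span_singleton] at hz
  obtain ⟨c, rfl⟩ := hz
  exact ⟨c, (Algebra.algebraMap_eq_smul_one c).symm⟩

theorem one_mem_degreeLE (n : ℕ) : (1 : USu3) ∈ degreeLE n :=
  Submodule.subset_span ⟨[], by simp, by simp⟩

theorem degreeLE_one_le {N : Submodule ℂ USu3} (h0 : 1 ∈ N) (h1 : ∀ X, ofLie X ∈ N) :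
    degreeLE 1 ≤ N := by
  rw [degreeLE, Submodule.span_le]
  rintro _ ⟨l, hl, rfl⟩
  match l, hl with
  | [], _ => simpa using h0
  | [X], _ => simpa using h1 X
  | _ :: _ :: _, hl => simp at hl

theorem degreeLE_two_le {N : Submodule ℂ USu3} (h0 : 1 ∈ N) (h1 : ∀ X, ofLie X ∈ N)
    (h2 : ∀ X Y, ofLie X * ofLie Y ∈ N) : degreeLE 2 ≤ N := by
  rw [degreeLE, Submodule.span_le]
  rintro _ ⟨l, hl, rfl⟩
  match l, hl with
  | [], _ => simpa using h0
  | [X], _ => simpa using h1 X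
  | [X, Y], _ => simpa using h2 X Y
  | _ :: _ :: _ :: _, hl => simp at hl

theorem degreeLE_three_le {N : Submodule ℂ USu3} (h0 : 1 ∈ N) (h1 : ∀ X, ofLie X ∈ N)
    (h2 : ∀ X Y, ofLie X * ofLie Y ∈ N) (h3 : ∀ X Y Z, ofLie X * ofLie Y * ofLie Z ∈ N) :
    degreeLE 3 ≤ N := by
  rw [degreeLE, Submodule.span_le]
  rintro _ ⟨l, hl, rfl⟩
  match l, hl with
  | [], _ => simpa using h0
  | [X], _ => simpa using h1 X
  | [X, Y], _ => simpa using h2 X Y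
  | [X, Y, Z], _ => simpa [mul_assoc] using h3 X Y Z
  | _ :: _ :: _ :: _ :: _, hl => simp at hl; omega

/-! ### Linear forms and products on a threefold tensor power -/

section TensorCube

variable {B : Type*} [Ring B] [Algebra ℂ B]

/-- The threefold tensor power of an algebra. -/
abbrev TensorCube (B : Type*) [Ring B] [Algebra ℂ B] : Type _ := B ⊗[ℂ] (B ⊗[ℂ] B)

/-- The diagonal action `m ↦ m ⊗ 1 ⊗ 1 + 1 ⊗ m ⊗ 1 + 1 ⊗ 1 ⊗ m`. -/
def diagonal (m : B) : TensorCube B := m ⊗ₜ (1 ⊗ₜ 1) + 1 ⊗ₜ (m ⊗ₜ 1) + 1 ⊗ₜ (1 ⊗ₜ m)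

theorem diagonal_add (m n : B) : diagonal (m + n) = diagonal m + diagonal n := by
  simp only [diagonal, TensorProduct.add_tmul, TensorProduct.tmul_add]
  abel

theorem diagonal_smul (c : ℂ) (m : B) : diagonal (c • m) = c • diagonal m := by
  simp only [diagonal, ← TensorProduct.smul_tmul', TensorProduct.tmul_smul, smul_add]

theorem diagonal_commutator (m n : B) :
    diagonal (m * n - n * m) = diagonal m * diagonal n - diagonal n * diagonal m := by
  simp only [diagonal, mul_add, add_mul, Algebra.TensorProduct.tmul_mul_tmul, mul_one, one_mul,
    TensorProduct.sub_tmul, TensorProduct.tmul_sub]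
  abel

/-- The linear form `a ⊗ b ⊗ c` on the threefold tensor power. -/
def tensorForm (a b c : Module.Dual ℂ B) : Module.Dual ℂ (TensorCube B) :=
  TensorProduct.dualDistrib ℂ B (B ⊗[ℂ] B) (a ⊗ₜ TensorProduct.dualDistrib ℂ B B (b ⊗ₜ c))

theorem tensorForm_tmul (a b c : Module.Dual ℂ B) (x y z : B) :
    tensorForm a b c (x ⊗ₜ (y ⊗ₜ z)) = a x * (b y * c z) := by
  simp only [tensorForm, TensorProduct.dualDistrib_apply]

theorem TensorCube.induction {p : TensorCube B → Prop} (zero : p 0)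
    (tmul : ∀ x y z, p (x ⊗ₜ (y ⊗ₜ z))) (add : ∀ s t, p s → p t → p (s + t))
    (t : TensorCube B) : p t := by
  induction t using TensorProduct.induction_on with
  | zero => exact zero
  | add s t hs ht => exact add s t hs ht
  | tmul x w =>
    induction w using TensorProduct.induction_on with
    | zero => rw [TensorProduct.tmul_zero]; exact zero
    | add s t hs ht => rw [TensorProduct.tmul_add]; exact add _ _ hs ht
    | tmul y z => exact tmul x y z

/-- Bracketing with `diagonal m` is a derivation acting slot by slot; the primed forms are the
transposes of `ad m`. -/
theorem tensorForm_commutator {m : B} {a b c a' b' c' : Module.Dual ℂ B}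
    (ha : ∀ x, a (m * x - x * m) = a' x) (hb : ∀ x, b (m * x - x * m) = b' x)
    (hc : ∀ x, c (m * x - x * m) = c' x) (t : TensorCube B) :
    tensorForm a b c (diagonal m * t - t * diagonal m)
      = tensorForm a' b c t + tensorForm a b' c t + tensorForm a b c' t := by
  induction t using TensorCube.induction with
  | zero => simp only [mul_zero, zero_mul, sub_zero, map_zero, add_zero]
  | add s t hs ht =>
    rw [mul_add, add_mul, add_sub_add_comm, map_add, hs, ht]
    simp only [map_add]
    ring
  | tmul x y z =>
    simp only [diagonal, mul_add, add_mul, Algebra.TensorProduct.tmul_mul_tmul, mul_one, one_mul,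
      map_add, map_sub, tensorForm_tmul, ← ha, ← hb, ← hc]
    ring

theorem tensorForm_sub_left (a a' b c : Module.Dual ℂ B) :
    tensorForm (a - a') b c = tensorForm a b c - tensorForm a' b c := by
  simp only [tensorForm, TensorProduct.sub_tmul, map_sub]

theorem tensorForm_add_left (a a' b c : Module.Dual ℂ B) :
    tensorForm (a + a') b c = tensorForm a b c + tensorForm a' b c := by
  simp only [tensorForm, TensorProduct.add_tmul, map_add]

theorem tensorForm_sub_middle (a b b' c : Module.Dual ℂ B) :
    tensorForm a (b - b') c = tensorForm a b c - tensorForm a b' c := by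
  simp only [tensorForm, TensorProduct.sub_tmul, TensorProduct.tmul_sub, map_sub]

theorem tensorForm_sub_right (a b c c' : Module.Dual ℂ B) :
    tensorForm a b (c - c') = tensorForm a b c - tensorForm a b c' := by
  simp only [tensorForm, TensorProduct.tmul_sub, map_sub]

theorem tensorForm_zero_left (b c : Module.Dual ℂ B) : tensorForm 0 b c = 0 := by
  simp only [tensorForm, TensorProduct.zero_tmul, map_zero]

theorem tensorForm_zero_middle (a c : Module.Dual ℂ B) : tensorForm a 0 c = 0 := by
  simp only [tensorForm, TensorProduct.zero_tmul, TensorProduct.tmul_zero, map_zero]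

theorem tensorForm_zero_right (a b : Module.Dual ℂ B) : tensorForm a b 0 = 0 := by
  simp only [tensorForm, TensorProduct.tmul_zero, map_zero]

/-- The product `x ⊗ y ⊗ z ↦ α x * β y * γ z`. -/
def tensorProd {U : Type*} [Ring U] [Algebra ℂ U] (α β γ : B →ₗ[ℂ] U) : TensorCube B →ₗ[ℂ] U :=
  LinearMap.mul' ℂ U ∘ₗ TensorProduct.map α (LinearMap.mul' ℂ U ∘ₗ TensorProduct.map β γ)

variable {U : Type*} [Ring U] [Algebra ℂ U] {α β γ : B →ₗ[ℂ] U}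

theorem tensorProd_tmul (x y z : B) :
    tensorProd α β γ (x ⊗ₜ (y ⊗ₜ z)) = α x * (β y * γ z) := by
  simp only [tensorProd, LinearMap.comp_apply, TensorProduct.map_tmul, LinearMap.mul'_apply]

theorem tensorProd_eq_sum {ι κ μ : Type*} [Fintype ι] [Fintype κ] [Fintype μ]
    {a : ι → Module.Dual ℂ B} {b : κ → Module.Dual ℂ B}
    {c : μ → Module.Dual ℂ B} {u : ι → U} {v : κ → U} {w : μ → U}
    (hα : ∀ x, α x = ∑ i, a i x • u i) (hβ : ∀ x, β x = ∑ i, b i x • v i)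
    (hγ : ∀ x, γ x = ∑ i, c i x • w i) (t : TensorCube B) :
    tensorProd α β γ t = ∑ i, ∑ j, ∑ k, tensorForm (a i) (b j) (c k) t • (u i * (v j * w k)) := by
  induction t using TensorCube.induction with
  | zero => simp only [map_zero, zero_smul, Finset.sum_const_zero]
  | add s t hs ht => rw [map_add, hs, ht]; simp only [map_add, add_smul, Finset.sum_add_distrib]
  | tmul x y z =>
    rw [tensorProd_tmul, hα, hβ, hγ, Finset.sum_mul_sum, Finset.sum_mul]
    refine Finset.sum_congr rfl fun i _ => ?_
    rw [Finset.mul_sum]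
    refine Finset.sum_congr rfl fun j _ => ?_
    rw [Finset.mul_sum]
    refine Finset.sum_congr rfl fun k _ => ?_
    rw [tensorForm_tmul, smul_mul_smul_comm, smul_mul_smul_comm]

/-- Of the 27 terms only those with no slot left equal to `1` survive, that is, the six bijections
between factors and slots. -/
theorem tensorForm_diagonal_three {a b c : Module.Dual ℂ B} (ha : a 1 = 0) (hb : b 1 = 0)
    (hc : c 1 = 0) (x y z : B) :
    tensorForm a b c (diagonal x * diagonal y * diagonal z) =
      a x * b y * c z + a x * b z * c y + a y * b x * c z + a y * b z * c x + a z * b x * c y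
        + a z * b y * c x := by
  simp only [diagonal, mul_add, add_mul, Algebra.TensorProduct.tmul_mul_tmul, mul_one, one_mul,
    map_add, tensorForm_tmul, ha, hb, hc, mul_zero, zero_mul]
  ring

theorem tensorForm_diagonal_two {a b c : Module.Dual ℂ B} (ha : a 1 = 0) (hb : b 1 = 0)
    (x y : B) :
    tensorForm a b c (diagonal x * diagonal y) = (a x * b y + a y * b x) * c 1 := by
  simp only [diagonal, mul_add, add_mul, Algebra.TensorProduct.tmul_mul_tmul, mul_one, one_mul,
    map_add, tensorForm_tmul, ha, hb, mul_zero, zero_mul]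
  ring

theorem tensorForm_diagonal (a b c : Module.Dual ℂ B) (x : B) :
    tensorForm a b c (diagonal x) = a x * (b 1 * c 1) + a 1 * (b x * c 1) + a 1 * (b 1 * c x) := by
  simp only [diagonal, map_add, tensorForm_tmul]

theorem tensorForm_one (a b c : Module.Dual ℂ B) :
    tensorForm a b c 1 = a 1 * (b 1 * c 1) := by
  rw [Algebra.TensorProduct.one_def, Algebra.TensorProduct.one_def, tensorForm_tmul]

theorem tensorProd_diagonal_three (hα : α 1 = 0) (hβ : β 1 = 0) (hγ : γ 1 = 0) (x y z : B) :
    tensorProd α β γ (diagonal x * diagonal y * diagonal z) =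
      α x * (β y * γ z) + α x * (β z * γ y) + α y * (β x * γ z) + α y * (β z * γ x)
        + α z * (β x * γ y) + α z * (β y * γ x) := by
  simp only [diagonal, mul_add, add_mul, Algebra.TensorProduct.tmul_mul_tmul, mul_one, one_mul,
    map_add, tensorProd_tmul, hα, hβ, hγ, mul_zero, zero_mul]
  abel

theorem tensorProd_diagonal_two (hα : α 1 = 0) (hβ : β 1 = 0) (x y : B) :
    tensorProd α β γ (diagonal x * diagonal y) = α x * (β y * γ 1) + α y * (β x * γ 1) := by
  simp only [diagonal, mul_add, add_mul, Algebra.TensorProduct.tmul_mul_tmul, mul_one, one_mul,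
    map_add, tensorProd_tmul, hα, hβ, mul_zero, zero_mul]
  abel

theorem tensorProd_diagonal (hα : α 1 = 0) (x : B) :
    tensorProd α β γ (diagonal x) = α x * (β 1 * γ 1) := by
  simp only [diagonal, map_add, tensorProd_tmul, hα, zero_mul, add_zero]

theorem tensorProd_one : tensorProd α β γ 1 = α 1 * (β 1 * γ 1) := by
  rw [Algebra.TensorProduct.one_def, Algebra.TensorProduct.one_def, tensorProd_tmul]

end TensorCube

/-- Complex `3 × 3` matrices. -/
abbrev M3 : Type := Matrix (Fin 3) (Fin 3) ℂ

/-- A Lie algebra homomorphism from `su(3)` to a complex algebra. -/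
def lieHomOf {A : Type*} [Ring A] [Algebra ℂ A] (f : su3 → A)
    (hadd : ∀ X Y, f (X + Y) = f X + f Y) (hsmul : ∀ (r : ℝ) X, f (r • X) = (r : ℂ) • f X)
    (hlie : ∀ X Y, f ⁅X, Y⁆ = f X * f Y - f Y * f X) : su3 →ₗ⁅ℝ⁆ A where
  toFun := f
  map_add' := hadd
  map_smul' r X := by rw [hsmul]; exact Complex.coe_smul r (f X)
  map_lie' := by intro X Y; exact hlie X Y

/-- The action of the enveloping algebra on the third tensor power of the defining
representation. -/
def tensorCube : USu3 →ₐ[ℂ] TensorCube M3 :=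
  liftC (lieHomOf (fun X => diagonal X.1) (fun X Y => diagonal_add X.1 Y.1)
    (fun r X => diagonal_smul (r : ℂ) X.1) (fun X Y => diagonal_commutator X.1 Y.1))

theorem tensorCube_ofLie (X : su3) : tensorCube (ofLie X) = diagonal X.1 :=
  liftC_ofLie _ X

theorem tensorCube_ofMatrix (M : M3) :
    tensorCube (ofMatrix M) = diagonal (M - (M.trace / 3) • 1) := by
  obtain ⟨X, Y, t, rfl⟩ := exists_decomposition M
  rw [ofMatrix_decomposition, map_add, map_smul, tensorCube_ofLie, tensorCube_ofLie,
    ← diagonal_smul, ← diagonal_add]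
  congr 1
  have hX : X.1.trace = 0 := X.2.2
  have hY : Y.1.trace = 0 := Y.2.2
  simp [hX, hY]

/-- The linear form `m ↦ tr (E i j * m)`, corrected so that it vanishes on scalars. -/
def traceForm (i j : Fin 3) : Module.Dual ℂ M3 :=
  Matrix.entryLinearMap ℂ ℂ j i
    - (if i = j then 1 / 3 else 0 : ℂ) • Matrix.traceLinearMap (Fin 3) ℂ ℂ

theorem traceForm_apply (i j : Fin 3) (m : M3) :
    traceForm i j m = m j i - (if i = j then 1 / 3 else 0) * m.trace := rfl

theorem traceForm_one (i j : Fin 3) : traceForm i j 1 = 0 := by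
  rw [traceForm_apply, Matrix.one_apply]
  by_cases h : i = j
  · simp [h]
  · simp [h, Ne.symm h]

theorem traceForm_sum : traceForm 0 0 + traceForm 1 1 + traceForm 2 2 = 0 := by
  ext m
  simp only [LinearMap.add_apply, traceForm_apply, Matrix.trace_fin_three, LinearMap.zero_apply]
  simp
  ring

/-- The coadjoint action in indices; the trace correction drops out on commutators. The free scalar
`c` accommodates the traceless part in `tensorCube_ofMatrix`. -/
theorem traceForm_commutator (i j p q : Fin 3) (c : ℂ) (m : M3) :
    traceForm i j ((Matrix.single p q 1 - c • 1) * m - m * (Matrix.single p q 1 - c • 1)) =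
      ((if j = p then traceForm i q else 0) - (if q = i then traceForm p j else 0)) m := by
  have h : (Matrix.single p q 1 - c • 1) * m - m * (Matrix.single p q 1 - c • 1)
      = Matrix.single p q 1 * m - m * Matrix.single p q (1 : ℂ) := by
    simp [sub_mul, mul_sub]
  have h1 : (Matrix.single p q (1 : ℂ) * m) j i = if j = p then m q i else 0 := by
    split_ifs with h
    · subst h; simp
    · simp [h]
  have h2 : (m * Matrix.single p q (1 : ℂ)) j i = if q = i then m j p else 0 := by
    split_ifs with h
    · subst h; simp
    · simp [Ne.symm h]
  rw [h, traceForm_apply, Matrix.trace_sub, Matrix.trace_mul_comm, sub_self, mul_zero, sub_zero,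
    Matrix.sub_apply, h1, h2, LinearMap.sub_apply]
  split_ifs <;> subst_vars <;>
    simp only [traceForm_apply, if_true, LinearMap.zero_apply] <;> grind

/-- The normalised trace. -/
def meanForm : Module.Dual ℂ M3 := (1 / 3 : ℂ) • Matrix.traceLinearMap (Fin 3) ℂ ℂ

theorem meanForm_one : meanForm 1 = 1 := by
  simp [meanForm]

theorem meanForm_commutator (m x : M3) :
    meanForm (m * x - x * m) = (0 : Module.Dual ℂ M3) x := by
  simp [meanForm, Matrix.trace_mul_comm m x]

theorem ofMatrix_eq_sum (m : M3) :
    ofMatrix m = ∑ p : Fin 3 × Fin 3, traceForm p.1 p.2 m • unit p.2 p.1 := by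
  rw [ofMatrix_apply, Fintype.sum_prod_type]
  simp only [Fin.sum_univ_three, traceForm_apply, Matrix.trace_fin_three, unit]
  simp
  module

theorem ofMatrix_coe (X : su3) : ofMatrix X.1 = ofLie X := (ofLie_eq_ofMatrix X).symm

/-! ### Symmetrisation: recovering an element from its symbol modulo lower degree -/

theorem commutator_mem_degreeLE_one (X Y : su3) :
    ofLie X * ofLie Y - ofLie Y * ofLie X ∈ degreeLE 1 := by
  rw [← ofLie_lie]; exact ofLie_mem_degreeLE _

/-- The linear map `m ↦ (tr m / 3) • 1`. -/
def meanMap : M3 →ₗ[ℂ] USu3 := meanForm.smulRight 1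

theorem meanMap_apply (m : M3) : meanMap m = meanForm m • 1 := rfl

theorem meanMap_one : meanMap 1 = 1 := by rw [meanMap_apply, meanForm_one, one_smul]

/-- On `XYZ` the product map returns the sum of the six orderings, each equal to `XYZ` modulo degree
two; on shorter products it returns zero because `ofMatrix` kills `1`. -/
theorem sub_tensorProd_mem_degreeLE_two {z : USu3} (hz : z ∈ degreeLE 3) :
    (6 : ℂ) • z - tensorProd ofMatrix ofMatrix ofMatrix (tensorCube z) ∈ degreeLE 2 := by
  let T : USu3 →ₗ[ℂ] USu3 := (6 : ℂ) • LinearMap.id -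
    tensorProd ofMatrix ofMatrix ofMatrix ∘ₗ tensorCube.toLinearMap
  have hT : ∀ x, T x = (6 : ℂ) • x - tensorProd ofMatrix ofMatrix ofMatrix (tensorCube x) :=
    fun x => rfl
  suffices degreeLE 3 ≤ (degreeLE 2).comap T from this hz
  apply degreeLE_three_le
  · rw [Submodule.mem_comap, hT, map_one, tensorProd_one, ofMatrix_one, zero_mul, sub_zero]
    exact Submodule.smul_mem _ _ (one_mem_degreeLE 2)
  · intro X
    rw [Submodule.mem_comap, hT, tensorCube_ofLie, tensorProd_diagonal ofMatrix_one, ofMatrix_one,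
      zero_mul, mul_zero, sub_zero]
    exact Submodule.smul_mem _ _ (degreeLE_mono one_le_two (ofLie_mem_degreeLE X))
  · intro X Y
    rw [Submodule.mem_comap, hT, map_mul tensorCube, tensorCube_ofLie, tensorCube_ofLie,
      tensorProd_diagonal_two ofMatrix_one ofMatrix_one, ofMatrix_one, mul_zero, mul_zero,
      mul_zero, add_zero, sub_zero]
    exact Submodule.smul_mem _ _ (mul_mem_degreeLE (ofLie_mem_degreeLE X) (ofLie_mem_degreeLE Y))
  · intro X Y Z
    rw [Submodule.mem_comap, hT, map_mul tensorCube, map_mul tensorCube, tensorCube_ofLie, tensorCube_ofLie,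
      tensorCube_ofLie, tensorProd_diagonal_three ofMatrix_one ofMatrix_one ofMatrix_one]
    simp only [ofMatrix_coe]
    have l : ∀ A B C : su3, ofLie A * (ofLie B * ofLie C - ofLie C * ofLie B) ∈ degreeLE 2 :=
      fun A B C => mul_mem_degreeLE (ofLie_mem_degreeLE A) (commutator_mem_degreeLE_one B C)
    have r : ∀ A B C : su3, (ofLie A * ofLie B - ofLie B * ofLie A) * ofLie C ∈ degreeLE 2 :=
      fun A B C => mul_mem_degreeLE (commutator_mem_degreeLE_one A B) (ofLie_mem_degreeLE C)
    -- Each of the other five orderings is reached from `XYZ` by adjacent swaps; the coefficients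
    -- count how often each swap occurs.
    have h := add_mem (add_mem (add_mem (add_mem (Submodule.smul_mem _ (2 : ℂ) (l X Y Z))
      (Submodule.smul_mem _ (3 : ℂ) (r X Y Z))) (Submodule.smul_mem _ (2 : ℂ) (l Y X Z)))
      (r X Z Y)) (r Y Z X)
    convert h using 1
    simp only [mul_sub, sub_mul, mul_assoc]
    module

/-- The same with two orderings; `meanMap` sends `1` to `1` and so absorbs the unused slot. -/
theorem sub_tensorProd_mem_degreeLE_one {z : USu3} (hz : z ∈ degreeLE 2) :
    (2 : ℂ) • z - tensorProd ofMatrix ofMatrix meanMap (tensorCube z) ∈ degreeLE 1 := by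
  let T : USu3 →ₗ[ℂ] USu3 := (2 : ℂ) • LinearMap.id -
    tensorProd ofMatrix ofMatrix meanMap ∘ₗ tensorCube.toLinearMap
  have hT : ∀ x, T x = (2 : ℂ) • x - tensorProd ofMatrix ofMatrix meanMap (tensorCube x) :=
    fun x => rfl
  suffices degreeLE 2 ≤ (degreeLE 1).comap T from this hz
  apply degreeLE_two_le
  · rw [Submodule.mem_comap, hT, map_one, tensorProd_one, ofMatrix_one, zero_mul, sub_zero]
    exact Submodule.smul_mem _ _ (one_mem_degreeLE 1)
  · intro X
    rw [Submodule.mem_comap, hT, tensorCube_ofLie, tensorProd_diagonal ofMatrix_one, ofMatrix_one,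
      zero_mul, mul_zero, sub_zero]
    exact Submodule.smul_mem _ _ (ofLie_mem_degreeLE X)
  · intro X Y
    rw [Submodule.mem_comap, hT, map_mul tensorCube, tensorCube_ofLie, tensorCube_ofLie,
      tensorProd_diagonal_two ofMatrix_one ofMatrix_one, meanMap_one, mul_one, mul_one]
    simp only [ofMatrix_coe]
    convert commutator_mem_degreeLE_one X Y using 1
    module

theorem sub_tensorProd_mem_degreeLE_zero {z : USu3} (hz : z ∈ degreeLE 1) :
    z - tensorProd ofMatrix meanMap meanMap (tensorCube z) ∈ degreeLE 0 := by
  let T : USu3 →ₗ[ℂ] USu3 := LinearMap.id -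
    tensorProd ofMatrix meanMap meanMap ∘ₗ tensorCube.toLinearMap
  have hT : ∀ x, T x = x - tensorProd ofMatrix meanMap meanMap (tensorCube x) :=
    fun x => rfl
  suffices degreeLE 1 ≤ (degreeLE 0).comap T from this hz
  apply degreeLE_one_le
  · rw [Submodule.mem_comap, hT, map_one, tensorProd_one, ofMatrix_one, zero_mul, sub_zero]
    exact one_mem_degreeLE 0
  · intro X
    rw [Submodule.mem_comap, hT, tensorCube_ofLie, tensorProd_diagonal ofMatrix_one, meanMap_one,
      mul_one, mul_one, ofMatrix_coe, sub_self]
    exact zero_mem _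

/-- The sum over `Unit` gives `meanMap` the shape required by `tensorProd_eq_sum`. -/
theorem meanMap_eq_sum (m : M3) : meanMap m = ∑ _ : Unit, meanForm m • (1 : USu3) := by
  simp [meanMap_apply]

theorem mem_degreeLE_two_of_tensorForm_eq_zero {z : USu3} (hz : z ∈ degreeLE 3)
    (h : ∀ i j k l m n,
      tensorForm (traceForm i j) (traceForm k l) (traceForm m n) (tensorCube z) = 0) :
    z ∈ degreeLE 2 := by
  have h6 := sub_tensorProd_mem_degreeLE_two hz
  rw [tensorProd_eq_sum ofMatrix_eq_sum ofMatrix_eq_sum ofMatrix_eq_sum] at h6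
  simp only [h, zero_smul, Finset.sum_const_zero, sub_zero] at h6
  exact (Submodule.smul_mem_iff _ (by norm_num)).1 h6

theorem mem_degreeLE_one_of_tensorForm_eq_zero {z : USu3} (hz : z ∈ degreeLE 2)
    (h : ∀ i j k l, tensorForm (traceForm i j) (traceForm k l) meanForm (tensorCube z) = 0) :
    z ∈ degreeLE 1 := by
  have h2 := sub_tensorProd_mem_degreeLE_one hz
  rw [tensorProd_eq_sum ofMatrix_eq_sum ofMatrix_eq_sum meanMap_eq_sum] at h2
  simp only [h, zero_smul, Finset.sum_const_zero, sub_zero] at h2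
  exact (Submodule.smul_mem_iff _ (by norm_num)).1 h2

theorem mem_degreeLE_zero_of_tensorForm_eq_zero {z : USu3} (hz : z ∈ degreeLE 1)
    (h : ∀ i j, tensorForm (traceForm i j) meanForm meanForm (tensorCube z) = 0) :
    z ∈ degreeLE 0 := by
  have h2 := sub_tensorProd_mem_degreeLE_zero hz
  rw [tensorProd_eq_sum ofMatrix_eq_sum meanMap_eq_sum meanMap_eq_sum] at h2
  simpa only [h, zero_smul, Finset.sum_const_zero, sub_zero] using h2

/-! ### Symmetry and invariance of the symbols -/

theorem tensorForm_comm_left {a b c : Module.Dual ℂ M3} (ha : a 1 = 0) (hb : b 1 = 0)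
    (hc : c 1 = 0) {z : USu3} (hz : z ∈ degreeLE 3) :
    tensorForm a b c (tensorCube z) = tensorForm b a c (tensorCube z) := by
  suffices degreeLE 3 ≤ LinearMap.eqLocus (tensorForm a b c ∘ₗ tensorCube.toLinearMap)
    (tensorForm b a c ∘ₗ tensorCube.toLinearMap) from this hz
  apply degreeLE_three_le <;> intros <;> rw [LinearMap.mem_eqLocus] <;>
    simp only [LinearMap.comp_apply, AlgHom.toLinearMap_apply, map_one, map_mul, tensorCube_ofLie,
      tensorForm_one, tensorForm_diagonal, tensorForm_diagonal_two ha hb,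
      tensorForm_diagonal_two hb ha, tensorForm_diagonal_three ha hb hc,
      tensorForm_diagonal_three hb ha hc, ha, hb, hc] <;> ring

theorem tensorForm_comm_right {a b c : Module.Dual ℂ M3} (ha : a 1 = 0) (hb : b 1 = 0)
    (hc : c 1 = 0) {z : USu3} (hz : z ∈ degreeLE 3) :
    tensorForm a b c (tensorCube z) = tensorForm a c b (tensorCube z) := by
  suffices degreeLE 3 ≤ LinearMap.eqLocus (tensorForm a b c ∘ₗ tensorCube.toLinearMap)
    (tensorForm a c b ∘ₗ tensorCube.toLinearMap) from this hz
  apply degreeLE_three_le <;> intros <;> rw [LinearMap.mem_eqLocus] <;>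
    simp only [LinearMap.comp_apply, AlgHom.toLinearMap_apply, map_one, map_mul, tensorCube_ofLie,
      tensorForm_one, tensorForm_diagonal, tensorForm_diagonal_two ha hb,
      tensorForm_diagonal_two ha hc, tensorForm_diagonal_three ha hb hc,
      tensorForm_diagonal_three ha hc hb, ha, hb, hc] <;> ring

theorem tensorForm_comm_of_degreeLE_two {a b c : Module.Dual ℂ M3} (ha : a 1 = 0) (hb : b 1 = 0)
    {z : USu3} (hz : z ∈ degreeLE 2) :
    tensorForm a b c (tensorCube z) = tensorForm b a c (tensorCube z) := by
  suffices degreeLE 2 ≤ LinearMap.eqLocus (tensorForm a b c ∘ₗ tensorCube.toLinearMap)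
    (tensorForm b a c ∘ₗ tensorCube.toLinearMap) from this hz
  apply degreeLE_two_le <;> intros <;> rw [LinearMap.mem_eqLocus] <;>
    simp only [LinearMap.comp_apply, AlgHom.toLinearMap_apply, map_one, map_mul, tensorCube_ofLie,
      tensorForm_one, tensorForm_diagonal, tensorForm_diagonal_two ha hb,
      tensorForm_diagonal_two hb ha, ha, hb] <;> ring

theorem tensorForm_eq_zero_of_degreeLE_two {a b c : Module.Dual ℂ M3} (ha : a 1 = 0)
    (hb : b 1 = 0) (hc : c 1 = 0) {z : USu3} (hz : z ∈ degreeLE 2) :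
    tensorForm a b c (tensorCube z) = 0 := by
  suffices degreeLE 2 ≤ LinearMap.ker (tensorForm a b c ∘ₗ tensorCube.toLinearMap) from this hz
  apply degreeLE_two_le <;> intros <;> rw [LinearMap.mem_ker] <;>
    simp only [LinearMap.comp_apply, AlgHom.toLinearMap_apply, map_one, map_mul, tensorCube_ofLie,
      tensorForm_one, tensorForm_diagonal, tensorForm_diagonal_two ha hb, ha, hb, hc] <;> ring

/-- The image of a central `z` commutes with the diagonal action of the traceless part of `E p q`;
pairing this vanishing commutator with `a ⊗ b ⊗ c` gives the derivation identity. -/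
theorem tensorForm_invariant {z : USu3} (hz : z ∈ Subalgebra.center ℂ USu3) (p q : Fin 3)
    {a b c a' b' c' : Module.Dual ℂ M3}
    (ha : ∀ (e : ℂ) (x : M3),
      a ((Matrix.single p q 1 - e • 1) * x - x * (Matrix.single p q 1 - e • 1)) = a' x)
    (hb : ∀ (e : ℂ) (x : M3),
      b ((Matrix.single p q 1 - e • 1) * x - x * (Matrix.single p q 1 - e • 1)) = b' x)
    (hc : ∀ (e : ℂ) (x : M3),
      c ((Matrix.single p q 1 - e • 1) * x - x * (Matrix.single p q 1 - e • 1)) = c' x) :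
    tensorForm a' b c (tensorCube z) + tensorForm a b' c (tensorCube z)
      + tensorForm a b c' (tensorCube z) = 0 := by
  have h := congrArg tensorCube (Subalgebra.mem_center_iff.1 hz (ofMatrix (Matrix.single p q 1)))
  rw [map_mul, map_mul, tensorCube_ofMatrix, ← sub_eq_zero] at h
  rw [← tensorForm_commutator (ha _) (hb _) (hc _), h, map_zero]

theorem tensorForm_ite_left (P : Prop) [Decidable P] (a b c : Module.Dual ℂ M3)
    (t : TensorCube M3) :
    tensorForm (if P then a else 0) b c t = if P then tensorForm a b c t else 0 := by
  split_ifs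
  · rfl
  · rw [tensorForm_zero_left]; rfl

theorem tensorForm_ite_middle (P : Prop) [Decidable P] (a b c : Module.Dual ℂ M3)
    (t : TensorCube M3) :
    tensorForm a (if P then b else 0) c t = if P then tensorForm a b c t else 0 := by
  split_ifs
  · rfl
  · rw [tensorForm_zero_middle]; rfl

theorem tensorForm_ite_right (P : Prop) [Decidable P] (a b c : Module.Dual ℂ M3)
    (t : TensorCube M3) :
    tensorForm a b (if P then c else 0) t = if P then tensorForm a b c t else 0 := by
  split_ifs
  · rfl
  · rw [tensorForm_zero_right]; rfl

theorem tensorForm_traceForm_sum (b c : Module.Dual ℂ M3) (t : TensorCube M3) :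
    tensorForm (traceForm 0 0) b c t + tensorForm (traceForm 1 1) b c t
      + tensorForm (traceForm 2 2) b c t = 0 := by
  rw [← LinearMap.add_apply, ← LinearMap.add_apply, ← tensorForm_add_left, ← tensorForm_add_left,
    traceForm_sum, tensorForm_zero_left, LinearMap.zero_apply]

/-- The coefficient of `E₁₀ E₂₁ E₀₂` in the cubic symbol. -/
def cubicCoeff : Module.Dual ℂ USu3 :=
  tensorForm (traceForm 0 1) (traceForm 1 2) (traceForm 2 0) ∘ₗ tensorCube.toLinearMap

/-- The coefficient of `E₁₀ E₀₁` in the quadratic symbol. -/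
def quadraticCoeff : Module.Dual ℂ USu3 :=
  tensorForm (traceForm 0 1) (traceForm 1 0) meanForm ∘ₗ tensorCube.toLinearMap

theorem cubicCoeff_apply (z : USu3) : cubicCoeff z =
    tensorForm (traceForm 0 1) (traceForm 1 2) (traceForm 2 0) (tensorCube z) := rfl

theorem quadraticCoeff_apply (z : USu3) : quadraticCoeff z =
    tensorForm (traceForm 0 1) (traceForm 1 0) meanForm (tensorCube z) := rfl

theorem cubicCoeff_eq_zero {z : USu3} (hz : z ∈ degreeLE 2) : cubicCoeff z = 0 :=
  tensorForm_eq_zero_of_degreeLE_two (traceForm_one _ _) (traceForm_one _ _) (traceForm_one _ _) hz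

/-- The cubic symbol is a symmetric invariant form with scalars in its kernel, and `cubicCoeff` is
the one value that determines it. -/
theorem mem_degreeLE_two_of_cubicCoeff_eq_zero {z : USu3} (hz : z ∈ degreeLE 3)
    (hc : z ∈ Subalgebra.center ℂ USu3) (h : cubicCoeff z = 0) : z ∈ degreeLE 2 := by
  apply mem_degreeLE_two_of_tensorForm_eq_zero hz
  intro i j k l m n
  refine InvariantTensor.trilinear_eq_zero (s := fun i j k l m n =>
    tensorForm (traceForm i j) (traceForm k l) (traceForm m n) (tensorCube z)) ?_ ?_ ?_ ?_ h
    i j k l m n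
  · intro i j k l m n
    exact tensorForm_comm_left (traceForm_one _ _) (traceForm_one _ _) (traceForm_one _ _) hz
  · intro i j k l m n
    exact tensorForm_comm_right (traceForm_one _ _) (traceForm_one _ _) (traceForm_one _ _) hz
  · intro k l m n
    exact tensorForm_traceForm_sum _ _ _
  · intro p q i j k l m n
    have := tensorForm_invariant hc p q (traceForm_commutator i j p q)
      (traceForm_commutator k l p q) (traceForm_commutator m n p q)
    simpa only [tensorForm_sub_left, tensorForm_sub_middle, tensorForm_sub_right,
      LinearMap.sub_apply, tensorForm_ite_left, tensorForm_ite_middle, tensorForm_ite_right]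
      using this

theorem mem_degreeLE_one_of_quadraticCoeff_eq_zero {z : USu3} (hz : z ∈ degreeLE 2)
    (hc : z ∈ Subalgebra.center ℂ USu3) (h : quadraticCoeff z = 0) : z ∈ degreeLE 1 := by
  apply mem_degreeLE_one_of_tensorForm_eq_zero hz
  intro i j k l
  refine InvariantTensor.bilinear_eq_zero (s := fun i j k l =>
    tensorForm (traceForm i j) (traceForm k l) meanForm (tensorCube z)) ?_ ?_ ?_ h i j k l
  · intro i j k l
    exact tensorForm_comm_of_degreeLE_two (traceForm_one _ _) (traceForm_one _ _) hz
  · intro k l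
    exact tensorForm_traceForm_sum _ _ _
  · intro p q i j k l
    have := tensorForm_invariant hc p q (traceForm_commutator i j p q)
      (traceForm_commutator k l p q) (fun _ => meanForm_commutator _)
    simpa only [tensorForm_sub_left, tensorForm_sub_middle, tensorForm_zero_right, add_zero,
      LinearMap.sub_apply, LinearMap.zero_apply, tensorForm_ite_left, tensorForm_ite_middle]
      using this

theorem mem_degreeLE_zero_of_mem_center {z : USu3} (hz : z ∈ degreeLE 1)
    (hc : z ∈ Subalgebra.center ℂ USu3) : z ∈ degreeLE 0 := by
  apply mem_degreeLE_zero_of_tensorForm_eq_zero hz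
  intro i j
  refine InvariantTensor.linear_eq_zero (s := fun i j =>
    tensorForm (traceForm i j) meanForm meanForm (tensorCube z)) ?_ ?_ i j
  · exact tensorForm_traceForm_sum _ _ _
  · intro p q i j
    have := tensorForm_invariant hc p q (traceForm_commutator i j p q)
      (fun _ => meanForm_commutator _) (fun _ => meanForm_commutator _)
    simpa only [tensorForm_sub_left, tensorForm_zero_right, tensorForm_zero_middle, add_zero,
      LinearMap.sub_apply, LinearMap.zero_apply, tensorForm_ite_left] using this

/-! ### Degrees and leading coefficients of the Casimir elements -/

theorem L_mem_degreeLE (a : Fin 8) : L a ∈ degreeLE 1 :=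
  Submodule.smul_mem _ _ (ofLie_mem_degreeLE _)

theorem Ω₂hat_mem_degreeLE : Ω₂hat ∈ degreeLE 2 := by
  rw [Ω₂hat_eq_sum]
  exact sum_mem fun a _ => Submodule.smul_mem _ _
    (mul_mem_degreeLE (L_mem_degreeLE a) (L_mem_degreeLE a))

theorem unit_mem_degreeLE (i j : Fin 3) : unit i j ∈ degreeLE 1 := by
  rw [← ofMatrix_single]
  obtain ⟨X, Y, t, h⟩ := exists_decomposition (Matrix.single i j 1)
  rw [h, ofMatrix_decomposition]
  exact add_mem (ofLie_mem_degreeLE X) (Submodule.smul_mem _ _ (ofLie_mem_degreeLE Y))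

theorem Ω₃_mem_degreeLE : Ω₃ ∈ degreeLE 3 := by
  have e1 : L₁₂ ∈ degreeLE 1 := unit_mem_degreeLE 0 1
  have e2 : L₆₇ ∈ degreeLE 1 := unit_mem_degreeLE 1 2
  have e3 : L₄₅ ∈ degreeLE 1 := unit_mem_degreeLE 0 2
  have f1 : Lbar₁₂ ∈ degreeLE 1 := unit_mem_degreeLE 1 0
  have f2 : Lbar₆₇ ∈ degreeLE 1 := unit_mem_degreeLE 2 1
  have f3 : Lbar₄₅ ∈ degreeLE 1 := unit_mem_degreeLE 2 0
  have k1 : h₁ ∈ degreeLE 1 := L_mem_degreeLE 2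
  have k2 : h₂ ∈ degreeLE 1 := by
    rw [← unit_sub_unit_eq_h₂]
    exact sub_mem (unit_mem_degreeLE 1 1) (unit_mem_degreeLE 2 2)
  have w2 : ∀ {x y : USu3}, x ∈ degreeLE 1 → y ∈ degreeLE 1 → x * y ∈ degreeLE 2 :=
    fun hx hy => mul_mem_degreeLE hx hy
  have w2' : ∀ {x y : USu3}, x ∈ degreeLE 1 → y ∈ degreeLE 1 → x * y ∈ degreeLE 3 :=
    fun hx hy => degreeLE_mono (by norm_num) (w2 hx hy)
  have w3 : ∀ {x y z : USu3}, x ∈ degreeLE 1 → y ∈ degreeLE 1 → z ∈ degreeLE 1 →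
      x * y * z ∈ degreeLE 3 := fun hx hy hz => mul_mem_degreeLE (w2 hx hy) hz
  have w3' : ∀ {x y : USu3}, x ∈ degreeLE 1 → y ∈ degreeLE 2 → x * y ∈ degreeLE 3 :=
    fun hx hy => mul_mem_degreeLE hx hy
  have w1 : ∀ {x : USu3}, x ∈ degreeLE 1 → x ∈ degreeLE 3 :=
    fun hx => degreeLE_mono (by norm_num) hx
  have sm : ∀ (n : ℕ) (c : ℂ) {x : USu3}, x ∈ degreeLE n → c • x ∈ degreeLE n :=
    fun n c _ hx => Submodule.smul_mem _ c hx
  rw [Ω₃]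
  refine add_mem (sub_mem (add_mem (add_mem (add_mem (add_mem ?_ ?_) ?_) ?_) ?_) ?_) ?_
  · exact sm _ _ (w3' k1 (sub_mem (add_mem (w2 f1 e1) (w2 f3 e3)) (sm _ _ (w2 f2 e2))))
  · exact sm _ _ (w3' k2 (sub_mem (sub_mem (sm _ _ (w2 f1 e1)) (w2 f3 e3)) (w2 f2 e2)))
  · exact w3 f3 e2 e1
  · exact w3 f2 f1 e3
  · exact w2' f1 e1
  · exact w2' f2 e2
  · exact sm _ _ (add_mem (add_mem (add_mem
      (sm _ _ (sub_mem (w3 k2 k1 k1) (w3 k2 k2 k1)))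
      (sm _ _ (sub_mem (w3 k1 k1 k1) (w3 k2 k2 k2))))
      (sub_mem (w2' k1 k1) (w2' k2 k2))) (sub_mem (w1 k1) (w1 k2)))

theorem tensorCube_unit {i j : Fin 3} (h : i ≠ j) :
    tensorCube (unit i j) = diagonal (Matrix.single i j 1) := by
  rw [← ofMatrix_single, tensorCube_ofMatrix, Matrix.trace_single_eq_of_ne (h := h), zero_div,
    zero_smul, sub_zero]

theorem tensorCube_unit_sub_unit (i j : Fin 3) : tensorCube (unit i i - unit j j)
    = diagonal (Matrix.single i i 1 - Matrix.single j j 1) := by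
  rw [← ofMatrix_single, ← ofMatrix_single, ← map_sub, tensorCube_ofMatrix, Matrix.trace_sub,
    Matrix.trace_single_eq_same, Matrix.trace_single_eq_same, sub_self, zero_div, zero_smul,
    sub_zero]

theorem tensorCube_L₁₂ : tensorCube L₁₂ = diagonal (Matrix.single 0 1 1) :=
  tensorCube_unit (i := 0) (j := 1) (by decide)

theorem tensorCube_L₄₅ : tensorCube L₄₅ = diagonal (Matrix.single 0 2 1) :=
  tensorCube_unit (i := 0) (j := 2) (by decide)

theorem tensorCube_L₆₇ : tensorCube L₆₇ = diagonal (Matrix.single 1 2 1) :=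
  tensorCube_unit (i := 1) (j := 2) (by decide)

theorem tensorCube_Lbar₁₂ : tensorCube Lbar₁₂ = diagonal (Matrix.single 1 0 1) :=
  tensorCube_unit (i := 1) (j := 0) (by decide)

theorem tensorCube_Lbar₄₅ : tensorCube Lbar₄₅ = diagonal (Matrix.single 2 0 1) :=
  tensorCube_unit (i := 2) (j := 0) (by decide)

theorem tensorCube_Lbar₆₇ : tensorCube Lbar₆₇ = diagonal (Matrix.single 2 1 1) :=
  tensorCube_unit (i := 2) (j := 1) (by decide)

theorem tensorCube_h₁ :
    tensorCube h₁ = diagonal (Matrix.single 0 0 1 - Matrix.single 1 1 1) := by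
  rw [← unit_sub_unit_eq_h₁, tensorCube_unit_sub_unit]

theorem tensorCube_h₂ :
    tensorCube h₂ = diagonal (Matrix.single 1 1 1 - Matrix.single 2 2 1) := by
  rw [← unit_sub_unit_eq_h₂, tensorCube_unit_sub_unit]

theorem traceForm_single (i j k l : Fin 3) (h : i ≠ j) :
    traceForm i j (Matrix.single k l 1) = if l = i ∧ k = j then 1 else 0 := by
  rw [traceForm_apply, if_neg h, zero_mul, sub_zero, Matrix.single_apply]
  simp only [and_comm]

/-- Only `L₁₂ * Lbar₁₂` and `Lbar₁₂ * L₁₂` contribute, each with `1`. -/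
theorem quadraticCoeff_Ω₂hat : quadraticCoeff Ω₂hat = 2 := by
  have h1 := fun x y : M3 => tensorForm_diagonal_two (c := meanForm) (traceForm_one 0 1)
    (traceForm_one 1 0) x y
  rw [Ω₂hat_eq_quadratic, quadraticCoeff_apply, ChevalleyRelations.quadratic]
  simp only [map_add, map_smul, map_mul tensorCube, tensorCube_L₁₂, tensorCube_L₄₅,
    tensorCube_L₆₇, tensorCube_Lbar₁₂, tensorCube_Lbar₄₅, tensorCube_Lbar₆₇, tensorCube_h₁,
    tensorCube_h₂, h1, map_sub, traceForm_single _ _ _ _ (show (0 : Fin 3) ≠ 1 by decide),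
    traceForm_single _ _ _ _ (show (1 : Fin 3) ≠ 0 by decide), meanForm_one]
  simp
  norm_num

/-- Only `Lbar₆₇ * Lbar₁₂ * L₄₅`, the product of `E₂₁`, `E₁₀`, `E₀₂`, contributes. -/
theorem cubicCoeff_Ω₃ : cubicCoeff Ω₃ = 1 := by
  have h3 := fun x y z : M3 => tensorForm_diagonal_three (traceForm_one 0 1) (traceForm_one 1 2)
    (traceForm_one 2 0) x y z
  have h2 := fun x y : M3 => tensorForm_diagonal_two (c := traceForm 2 0) (traceForm_one 0 1)
    (traceForm_one 1 2) x y
  rw [cubicCoeff_apply, Ω₃]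
  simp only [mul_add, mul_sub, mul_smul_comm, ← mul_assoc]
  simp only [map_add, map_sub, map_smul, map_mul tensorCube, tensorCube_L₁₂, tensorCube_L₄₅,
    tensorCube_L₆₇, tensorCube_Lbar₁₂, tensorCube_Lbar₄₅, tensorCube_Lbar₆₇, tensorCube_h₁,
    tensorCube_h₂, h3, h2, tensorForm_diagonal, traceForm_one,
    traceForm_single _ _ _ _ (show (0 : Fin 3) ≠ 1 by decide),
    traceForm_single _ _ _ _ (show (1 : Fin 3) ≠ 2 by decide),
    traceForm_single _ _ _ _ (show (2 : Fin 3) ≠ 0 by decide)]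
  simp

/-! ### Classification of the cubic central elements -/

theorem quadratic_add_cubic_mem_degreeLE (x : ℂ) : Ω₃ + x • (3 / 2 : ℂ) • Ω₂hat ∈ degreeLE 3 :=
  add_mem Ω₃_mem_degreeLE (Submodule.smul_mem _ _ (Submodule.smul_mem _ _
    (degreeLE_mono (by norm_num) Ω₂hat_mem_degreeLE)))

theorem cubicCoeff_combination (c x e : ℂ) :
    cubicCoeff (c • (Ω₃ + x • (3 / 2 : ℂ) • Ω₂hat) + algebraMap ℂ USu3 e) = c := by
  have h : algebraMap ℂ USu3 e ∈ degreeLE 2 := by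
    rw [Algebra.algebraMap_eq_smul_one]
    exact Submodule.smul_mem _ _ (one_mem_degreeLE 2)
  rw [map_add, map_smul, map_add, map_smul, map_smul, cubicCoeff_Ω₃,
    cubicCoeff_eq_zero Ω₂hat_mem_degreeLE, cubicCoeff_eq_zero h]
  simp

theorem isCubic_and_mem_center_combination {c : ℂ} (hc : c ≠ 0) (x e : ℂ) :
    IsCubic (c • (Ω₃ + x • (3 / 2 : ℂ) • Ω₂hat) + algebraMap ℂ USu3 e) ∧
      c • (Ω₃ + x • (3 / 2 : ℂ) • Ω₂hat) + algebraMap ℂ USu3 e ∈ Subalgebra.center ℂ USu3 := by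
  refine ⟨⟨?_, fun h => hc ?_⟩, ?_⟩
  · refine add_mem (Submodule.smul_mem _ _ (quadratic_add_cubic_mem_degreeLE x)) ?_
    rw [Algebra.algebraMap_eq_smul_one]
    exact Submodule.smul_mem _ _ (one_mem_degreeLE 3)
  · rw [← cubicCoeff_combination c x e, cubicCoeff_eq_zero h]
  · exact add_mem (Subalgebra.smul_mem _ (add_mem Ω₃_mem_center
      (Subalgebra.smul_mem _ (Subalgebra.smul_mem _ Ω₂hat_mem_center _) _)) _)
      (algebraMap_mem _ _)

theorem constTerm_combination (c x : ℂ) :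
    constTerm (c • (Ω₃ + x • (3 / 2 : ℂ) • Ω₂hat)) = 0 := by
  rw [map_smul, map_add, map_smul, map_smul, constTerm_Ω₂hat, constTerm_Ω₃]
  simp

/-- Subtracting central elements with matching leading coefficient lowers the degree from three to
two to one, and a central element of degree at most one is constant. -/
theorem exists_combination {z : USu3} (hz : IsCubic z) (hc : z ∈ Subalgebra.center ℂ USu3) :
    ∃ c x : ℂ, c ≠ 0 ∧
      z = c • (Ω₃ + x • (3 / 2 : ℂ) • Ω₂hat) + algebraMap ℂ USu3 (constTerm z) := by
  set c := cubicCoeff z with hcdef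
  have hc0 : c ≠ 0 := fun h => hz.2 (mem_degreeLE_two_of_cubicCoeff_eq_zero hz.1 hc h)
  -- No division is needed for `c`, as `cubicCoeff` is `1` on `Ω₃`; the `2` in `d` below is the
  -- value of `quadraticCoeff` on `Ω₂hat`.
  have z1c : z - c • Ω₃ ∈ Subalgebra.center ℂ USu3 :=
    sub_mem hc (Subalgebra.smul_mem _ Ω₃_mem_center _)
  have z1d : z - c • Ω₃ ∈ degreeLE 2 := by
    refine mem_degreeLE_two_of_cubicCoeff_eq_zero
      (sub_mem hz.1 (Submodule.smul_mem _ _ Ω₃_mem_degreeLE)) z1c ?_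
    rw [map_sub, map_smul, cubicCoeff_Ω₃, ← hcdef, smul_eq_mul, mul_one, sub_self]
  set d := quadraticCoeff (z - c • Ω₃) / 2 with hd
  have z2c : z - c • Ω₃ - d • Ω₂hat ∈ Subalgebra.center ℂ USu3 :=
    sub_mem z1c (Subalgebra.smul_mem _ Ω₂hat_mem_center _)
  have z2d : z - c • Ω₃ - d • Ω₂hat ∈ degreeLE 1 := by
    refine mem_degreeLE_one_of_quadraticCoeff_eq_zero
      (sub_mem z1d (Submodule.smul_mem _ _ Ω₂hat_mem_degreeLE)) z2c ?_
    rw [map_sub _ _ (d • Ω₂hat), map_smul, quadraticCoeff_Ω₂hat, hd, smul_eq_mul,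
      div_mul_cancel₀ _ two_ne_zero, sub_self]
  obtain ⟨e, he⟩ := mem_degreeLE_zero (mem_degreeLE_zero_of_mem_center z2d z2c)
  have hz' : z = c • (Ω₃ + (d / c * (2 / 3)) • (3 / 2 : ℂ) • Ω₂hat) + algebraMap ℂ USu3 e := by
    rw [← he, smul_add, smul_smul, smul_smul,
      show c * (d / c * (2 / 3)) * (3 / 2) = d by field_simp]
    abel
  have hce : constTerm z = e := by
    rw [hz', map_add, constTerm_combination, zero_add, AlgHom.commutes]
    rfl
  exact ⟨c, d / c * (2 / 3), hc0, by rw [hce]; exact hz'⟩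

theorem adj_combination (c x : ℂ) :
    adj (c • (Ω₃ + x • (3 / 2 : ℂ) • Ω₂hat))
      = star c • (Ω₃ + star x • (3 / 2 : ℂ) • Ω₂hat) := by
  have h : star (3 / 2 : ℂ) = 3 / 2 := by simp
  rw [adj_smul, map_add, adj_smul, adj_smul, adj_Ω₃, adj_Ω₂hat, h]

theorem combination_injective {c x c' x' : ℂ} (hc : c ≠ 0)
    (h : c • (Ω₃ + x • (3 / 2 : ℂ) • Ω₂hat) = c' • (Ω₃ + x' • (3 / 2 : ℂ) • Ω₂hat)) :
    c = c' ∧ x = x' := by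
  have hcc : c = c' := by
    rw [← cubicCoeff_combination c x 0, ← cubicCoeff_combination c' x' 0, h]
  subst hcc
  refine ⟨rfl, ?_⟩
  have h2 := congrArg quadraticCoeff (add_left_cancel (smul_right_injective USu3 hc h))
  simp only [map_smul, quadraticCoeff_Ω₂hat, smul_eq_mul] at h2
  -- The quadratic coefficient of `x • (3 / 2) • Ω₂hat` is `3 * x`.
  linear_combination (1 / 3 : ℂ) * h2

end USu3

end

theorem mainTheorem9 :
    (∀ z : USu3, (USu3.IsCubic z ∧ z ∈ Subalgebra.center ℂ USu3) ↔
      ∃ c x : ℂ, c ≠ 0 ∧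
        z = c • (USu3.Ω₃ + x • (3 / 2 : ℂ) • USu3.Ω₂hat)
          + algebraMap ℂ USu3 (USu3.constTerm z)) ∧
    (∀ z : USu3, (USu3.IsCubic z ∧ z ∈ Subalgebra.center ℂ USu3 ∧
        USu3.constTerm z = 0 ∧ USu3.adj z = z) ↔
      ∃ c x : ℝ, c ≠ 0 ∧
        z = (c : ℂ) • (USu3.Ω₃ + (x : ℂ) • (3 / 2 : ℂ) • USu3.Ω₂hat)) ∧
    (∀ (V : Type*) [AddCommGroup V] [Module ℂ V] (ρ : su3 →ₗ⁅ℝ⁆ Module.End ℂ V) (o₁ o₂ : ℕ),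
      USu3.IsIrrepOfHighestWeight ρ o₁ o₂ →
      ∀ v : V, USu3.eval ρ USu3.Ω₃ v =
        ((o₁ - o₂) * (3 + 2 * o₁ + o₂) * (3 + o₁ + 2 * o₂) / 27 : ℂ) • v) := by
  refine ⟨fun z => ⟨fun ⟨hz, hc⟩ => USu3.exists_combination hz hc, ?_⟩, fun z => ⟨?_, ?_⟩,
    fun V _ _ ρ o₁ o₂ h v => USu3.eval_Ω₃_of_isIrrepOfHighestWeight h v⟩
  · rintro ⟨c, x, hc, hz⟩
    rw [hz]
    exact USu3.isCubic_and_mem_center_combination hc x _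
  · rintro ⟨hz, hc, h0, hadj⟩
    obtain ⟨c, x, hc0, hzc⟩ := USu3.exists_combination hz hc
    rw [h0, map_zero, add_zero] at hzc
    rw [hzc, USu3.adj_combination] at hadj
    -- Conjugation replaces `c` and `x` by their complex conjugates; since an element determines its
    -- parameters, both are real.
    obtain ⟨h1, h2⟩ := USu3.combination_injective (star_ne_zero.2 hc0) hadj
    obtain ⟨r, rfl⟩ := Complex.conj_eq_iff_real.1 h1
    obtain ⟨s, rfl⟩ := Complex.conj_eq_iff_real.1 h2
    exact ⟨r, s, by simpa using hc0, hzc⟩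
  · rintro ⟨c, x, hc, rfl⟩
    have h := USu3.isCubic_and_mem_center_combination (Complex.ofReal_ne_zero.2 hc) x 0
    rw [map_zero, add_zero] at h
    refine ⟨h.1, h.2, USu3.constTerm_combination _ _, ?_⟩
    rw [USu3.adj_combination, Complex.star_def, Complex.conj_ofReal,
      Complex.conj_ofReal]
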